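/- Let $(M,g)$ be a smooth pseudo-Riemannian manifold (Hausdorff, finite-dimensional, without boundary) with contravariant metric $G$ and Levi-Civita connection $\nabla$. Let $T$ be a smooth symmetric contravariant $2$-tensor field whose associated endomorphism of $TM$ is pointwise diagonalizable over $\mathbb{R}$, with smooth, pointwise distinct eigenfunctions $\lambda_1,\dots,\lambda_k$ (each an eigenvalue at every point) and eigenspaces $E_i=\ker(T-\lambda_i I)$, so that $TM$ is the orthogonal direct sum of $E_1,\dots,E_k$. Assume that the eigenspaces are orthogonally integrable: each point has a neighbourhood diffeomorphic to a product manifold $\prod_{i=1}^k M_i$ such that, for each $i$, the slices along $M_i$ are mapped to integral manifolds of $E_i$. For a vector field $x$ write $x=\sum_i x^i$ with $x^i\in\Gamma(E_i)$. For a nondegenerate distribution $E$ of rank $m$ and $X,Y\in\Gamma(E)$ let $s^E(X,Y)=(\nabla_XY)^{E^\perp}$, let $h^E$ be the symmetric part of $s^E$ and $H_E=\frac1m\operatorname{tr}h^E$ its mean curvature normal. $E$ is called geodesic if $s^E=0$; umbilical if $s^E(X,Y)=\langle X,Y\rangle H_E$ for all $X,Y\in\Gamma(E)$; spherical if it is umbilical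 and $(\nabla_XH_E)^{E^\perp}=0$ for all $X\in\Gamma(E)$; Killing if $E$ is spherical and $E^\perp$ is geodesic. Suppose that $T$ is a conformal Killing tensor with conformal factor the vector field $t$, i.e. $[T,G]=-2\,t\odot G$, where $[\cdot,\cdot]$ is the Schouten bracket, $[K,L]^{ijk}=2K^{l(i}\partial_lL^{jk)}-2L^{l(i}\partial_lK^{jk)}$, and $(t\odot G)^{ijk}=t^{(i}G^{jk)}$. Then for every $i$: 1. $E_i$ is Killing if and only if $(\nabla\lambda_j)^i=t^i$ for all $j\neq i$; 2. $E_i$ is geodesic if and only if $(\nabla\lambda_i)^j=t^j$ for all $j\neq i$. In particular, if $T$ is a Killing tensor (that is, $t=0$), then for every $i$: $E_i$ is Killing if and only if all the eigenfunctions $\lambda_1,\dots,\lambda_k$ are independent of $E_i$ (i.e. $d\lambda_j$ vanishes on $E_i$ for all $j$, including $j=i$); and $E_i$ is geodesic if and only if $\lambda_i$ is locally constant, hence, if $M$ is connected, if and only if $\lambda_i$ is constant. -/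

import Mathlib

open Bundle Set
open scoped Manifold ContDiff Topology

noncomputable section

namespace PseudoRiemannian

variable {E : Type*} [NormedAddCommGroup E] [NormedSpace ℝ E]
  {M : Type*} [TopologicalSpace M] [ChartedSpace E M]

/-! ### Tangent vectors, covectors, metrics and tensors -/

/-- The tangent space of `M` at `p`. -/
abbrev Tan (E : Type*) [NormedAddCommGroup E] [NormedSpace ℝ E]
    {M : Type*} [TopologicalSpace M] [ChartedSpace E M] (p : M) : Type _ :=
  TangentSpace 𝓘(ℝ, E) p

/-- The cotangent space of `M` at `p`. -/
abbrev Cotan (E : Type*) [NormedAddCommGroup E] [NormedSpace ℝ E]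
    {M : Type*} [TopologicalSpace M] [ChartedSpace E M] (p : M) : Type _ :=
  Tan E p →L[ℝ] ℝ

/-- The differential of a real function at `p`, as a covector. -/
abbrev diff (E : Type*) [NormedAddCommGroup E] [NormedSpace ℝ E]
    {M : Type*} [TopologicalSpace M] [ChartedSpace E M] (f : M → ℝ) (p : M) : Cotan E p :=
  mvfderiv 𝓘(ℝ, E) f p

/-- A smooth real function on `M`. -/
abbrev SmoothFun (E : Type*) [NormedAddCommGroup E] [NormedSpace ℝ E]
    {M : Type*} [TopologicalSpace M] [ChartedSpace E M] (f : M → ℝ) : Prop :=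
  ContMDiff 𝓘(ℝ, E) 𝓘(ℝ, ℝ) ∞ f

instance (p : M) [FiniteDimensional ℝ E] : FiniteDimensional ℝ (Tan E p) :=
  inferInstanceAs (FiniteDimensional ℝ E)

instance (p : M) : T2Space (Tan E p) :=
  inferInstanceAs (T2Space E)

variable [IsManifold 𝓘(ℝ, E) ∞ M]

/-- A smooth vector field on `M`. -/
abbrev SmoothField (X : ∀ p : M, Tan E p) : Prop :=
  ContMDiff 𝓘(ℝ, E) (𝓘(ℝ, E).prod 𝓘(ℝ, E)) ∞
    (fun p => TotalSpace.mk' E p (X p) : M → TotalSpace E (TangentSpace 𝓘(ℝ, E) : M → Type _))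

/-- The vector field `X` is differentiable at `p`. -/
abbrev DiffFieldAt (X : ∀ p : M, Tan E p) (p : M) : Prop :=
  MDifferentiableAt 𝓘(ℝ, E) (𝓘(ℝ, E).prod 𝓘(ℝ, E))
    (fun q => TotalSpace.mk' E q (X q) : M → TotalSpace E (TangentSpace 𝓘(ℝ, E) : M → Type _)) p

variable (E M) in
/-- A smooth pseudo-Riemannian metric: a smooth, symmetric, nondegenerate covariant `2`-tensor
field of arbitrary signature. -/
structure Metric where
  /-- The scalar product on the tangent space at `p`. -/
  val (p : M) : Tan E p →L[ℝ] Tan E p →L[ℝ] ℝ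
  symm (p : M) (v w : Tan E p) : val p v w = val p w v
  nondegenerate (p : M) (v : Tan E p) : (∀ w, val p v w = 0) → v = 0
  smooth : ContMDiff 𝓘(ℝ, E) (𝓘(ℝ, E).prod 𝓘(ℝ, E →L[ℝ] E →L[ℝ] ℝ)) ∞
    (fun p => TotalSpace.mk' (E →L[ℝ] E →L[ℝ] ℝ) p (val p) : M → TotalSpace (E →L[ℝ] E →L[ℝ] ℝ)
      (fun p : M => TangentSpace 𝓘(ℝ, E) p →L[ℝ] TangentSpace 𝓘(ℝ, E) p →L[ℝ] ℝ))

variable (E M) in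
/-- A smooth symmetric contravariant `2`-tensor field `T`. The bilinear form `T_p` on covectors is
stored as the linear map `α ↦ T_p(α, ·)` from the cotangent space to its dual, the tangent space;
thus `T_p(α, β) = β (val p α)`. -/
structure SymTensor where
  /-- The linear map `α ↦ T_p(α, ·)`. -/
  val (p : M) : Cotan E p →L[ℝ] Tan E p
  symm (p : M) (α β : Cotan E p) : β (val p α) = α (val p β)
  smooth : ContMDiff 𝓘(ℝ, E) (𝓘(ℝ, E).prod 𝓘(ℝ, (E →L[ℝ] ℝ) →L[ℝ] E)) ∞
    (fun p => TotalSpace.mk' ((E →L[ℝ] ℝ) →L[ℝ] E) p (val p) :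
      M → TotalSpace ((E →L[ℝ] ℝ) →L[ℝ] E)
        (fun p : M => (TangentSpace 𝓘(ℝ, E) p →L[ℝ] ℝ) →L[ℝ] TangentSpace 𝓘(ℝ, E) p))

namespace Metric

variable (g : Metric E M)

theorem flat_injective (p : M) : Function.Injective (g.val p) := by
  rw [injective_iff_map_eq_zero]
  intro v hv
  exact g.nondegenerate p v fun w => by simp [hv]

variable [FiniteDimensional ℝ E]

/-- The musical isomorphism `v ↦ ⟨v, ·⟩`. -/
def flat (p : M) : Tan E p ≃ₗ[ℝ] Cotan E p :=
  LinearEquiv.ofInjectiveOfFinrankEq (g.val p).toLinearMap (g.flat_injective p) (by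
    rw [← LinearEquiv.finrank_eq (LinearMap.toContinuousLinearMap (𝕜 := ℝ) (E := Tan E p) (F' := ℝ))]
    exact (Subspace.dual_finrank_eq).symm)

/-- The contravariant metric, as a map from covectors to vectors: the inverse of `flat`. -/
def sharp (p : M) : Cotan E p →L[ℝ] Tan E p :=
  LinearMap.toContinuousLinearMap (g.flat p).symm.toLinearMap

theorem val_sharp (p : M) (α : Cotan E p) (v : Tan E p) : g.val p (g.sharp p α) v = α v := by
  have h : g.flat p (g.sharp p α) = α := (g.flat p).apply_symm_apply α
  exact DFunLike.congr_fun h v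

/-- The gradient `∇ f`. -/
def grad (f : M → ℝ) (p : M) : Tan E p := g.sharp p (diff E f p)

end Metric

/-! ### The Levi-Civita connection -/

section LeviCivita

variable (g : Metric E M)

/-- The right hand side `⟨∇_X Y, Z⟩` of the Koszul formula. -/
def koszul (X Y Z : ∀ p : M, Tan E p) (p : M) : ℝ :=
  (1 / 2 : ℝ) *
    (diff E (fun q => g.val q (Y q) (Z q)) p (X p)
      + diff E (fun q => g.val q (Z q) (X q)) p (Y p)
      - diff E (fun q => g.val q (X q) (Y q)) p (Z p)
      + g.val p (VectorField.mlieBracket 𝓘(ℝ, E) X Y p) (Z p)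
      - g.val p (VectorField.mlieBracket 𝓘(ℝ, E) Y Z p) (X p)
      + g.val p (VectorField.mlieBracket 𝓘(ℝ, E) Z X p) (Y p))

variable {g}

theorem mdifferentiableAt_metric {X Y : ∀ p : M, Tan E p} {p : M}
    (hX : DiffFieldAt X p) (hY : DiffFieldAt Y p) :
    MDifferentiableAt 𝓘(ℝ, E) 𝓘(ℝ, ℝ) (fun q => g.val q (X q) (Y q)) p := by
  have h : MDifferentiableAt 𝓘(ℝ, E) (𝓘(ℝ, E).prod 𝓘(ℝ))
      (fun m ↦ TotalSpace.mk' ℝ (E := Bundle.Trivial M ℝ) m (g.val m (X m) (Y m))) p :=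
    MDifferentiableAt.clm_bundle_apply₂ (F₁ := E) (F₂ := E)
      (E₁ := (TangentSpace 𝓘(ℝ, E) : M → Type _)) (E₂ := (TangentSpace 𝓘(ℝ, E) : M → Type _))
      (g.smooth.mdifferentiable (by simp) p) hX hY
  rw [mdifferentiableAt_totalSpace] at h
  exact h.2

theorem eq_of_forall_field {p : M} {v w : Tan E p}
    (h : ∀ Z : ∀ p : M, Tan E p, DiffFieldAt Z p → g.val p v (Z p) = g.val p w (Z p)) : v = w := by
  refine g.flat_injective p (ContinuousLinearMap.ext fun z => ?_)
  have := h (FiberBundle.extend E z) (FiberBundle.mdifferentiableAt_extend ..)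
  simpa using this

variable [FiniteDimensional ℝ E]

/-- The Koszul expression depends on `Z` only through its value at the point. -/
theorem tensorialAt_koszul {X Y : ∀ p : M, Tan E p} {p : M}
    (hX : DiffFieldAt X p) (hY : DiffFieldAt Y p) :
    TensorialAt 𝓘(ℝ, E) E (fun Z => koszul g X Y Z p) p where
  smul {f Z} hf hZ := by
    have hYZ := mdifferentiableAt_metric (g := g) hY hZ
    have hZX := mdifferentiableAt_metric (g := g) hZ hX
    simp only [koszul, diff, Pi.smul_apply', map_smul, smul_apply, smul_eq_mul]
    rw [VectorField.mlieBracket_smul_right hf hZ, VectorField.mlieBracket_smul_left hf hZ]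
    have e1 := mvfderiv_mul hf hYZ
    have e2 := mvfderiv_mul hf hZX
    simp only [Pi.mul_def] at e1 e2
    rw [e1, e2]
    simp only [map_add, map_smul, add_apply, smul_apply,
      smul_eq_mul, map_neg, neg_apply, neg_smul]
    rw [g.symm p (Y p) (Z p)]
    ring
  add {Z W} hZ hW := by
    have hYZ := mdifferentiableAt_metric (g := g) hY hZ
    have hZX := mdifferentiableAt_metric (g := g) hZ hX
    have hYW := mdifferentiableAt_metric (g := g) hY hW
    have hWX := mdifferentiableAt_metric (g := g) hW hX
    simp only [koszul, diff, Pi.add_apply, map_add, add_apply]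
    rw [VectorField.mlieBracket_add_right hZ hW, VectorField.mlieBracket_add_left hZ hW]
    have e1 := mvfderiv_add hYZ hYW
    have e2 := mvfderiv_add hZX hWX
    simp only [Pi.add_def] at e1 e2
    rw [e1, e2]
    simp only [map_add, add_apply]
    ring

open Classical in
variable (g) in
/-- The Levi-Civita derivative `∇_X Y`: the vector field determined by the Koszul formula. It is
meaningful at the points where `X` and `Y` are differentiable. -/
def nabla (X Y : ∀ p : M, Tan E p) (p : M) : Tan E p :=
  if h : TensorialAt 𝓘(ℝ, E) E (fun Z => koszul g X Y Z p) p then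
    g.sharp p (TensorialAt.mkHom (fun Z => koszul g X Y Z p) p h)
  else 0

theorem nabla_koszul {X Y Z : ∀ p : M, Tan E p} {p : M}
    (hX : DiffFieldAt X p) (hY : DiffFieldAt Y p) (hZ : DiffFieldAt Z p) :
    g.val p (nabla g X Y p) (Z p) = koszul g X Y Z p := by
  rw [nabla, dif_pos (tensorialAt_koszul hX hY), g.val_sharp]
  exact TensorialAt.mkHom_apply (tensorialAt_koszul hX hY) hZ

theorem nabla_torsion_free {X Y : ∀ p : M, Tan E p} {p : M}
    (hX : DiffFieldAt X p) (hY : DiffFieldAt Y p) :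
    nabla g X Y p - nabla g Y X p = VectorField.mlieBracket 𝓘(ℝ, E) X Y p := by
  refine eq_of_forall_field (g := g) fun Z hZ => ?_
  have hc : ∀ A B : ∀ p : M, Tan E p,
      (fun q => g.val q (A q) (B q)) = fun q => g.val q (B q) (A q) :=
    fun A B => funext fun q => g.symm q _ _
  rw [map_sub, sub_apply, nabla_koszul hX hY hZ, nabla_koszul hY hX hZ, koszul,
    koszul, hc X Z, hc Z Y, hc Y X, VectorField.mlieBracket_swap_apply (V := Y) (W := X),
    VectorField.mlieBracket_swap_apply (V := X) (W := Z),
    VectorField.mlieBracket_swap_apply (V := Z) (W := Y)]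
  simp only [map_neg, neg_apply]
  ring

theorem nabla_metric {X Y Z : ∀ p : M, Tan E p} {p : M}
    (hX : DiffFieldAt X p) (hY : DiffFieldAt Y p) (hZ : DiffFieldAt Z p) :
    diff E (fun q => g.val q (Y q) (Z q)) p (X p)
      = g.val p (nabla g X Y p) (Z p) + g.val p (Y p) (nabla g X Z p) := by
  have hc : ∀ A B : ∀ p : M, Tan E p,
      (fun q => g.val q (A q) (B q)) = fun q => g.val q (B q) (A q) :=
    fun A B => funext fun q => g.symm q _ _
  rw [g.symm p (Y p), nabla_koszul hX hY hZ, nabla_koszul hX hZ hY, koszul,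
    koszul, hc X Z, hc Z Y, hc Y X, VectorField.mlieBracket_swap_apply (V := Y) (W := X),
    VectorField.mlieBracket_swap_apply (V := X) (W := Z),
    VectorField.mlieBracket_swap_apply (V := Z) (W := Y)]
  simp only [map_neg, neg_apply]
  ring

end LeviCivita

/-! ### Distributions -/

section Distributions

/-- A field of tangent subspaces. -/
abbrev Dist (E : Type*) [NormedAddCommGroup E] [NormedSpace ℝ E]
    (M : Type*) [TopologicalSpace M] [ChartedSpace E M] : Type _ :=
  ∀ p : M, Submodule ℝ (Tan E p)

/-- `X` is a smooth section of `D`, i.e. `X ∈ Γ(D)`. -/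
def IsSection (D : Dist E M) (X : ∀ p : M, Tan E p) : Prop :=
  SmoothField X ∧ ∀ p, X p ∈ D p

variable (g : Metric E M)

/-- The scalar product at `p` as a bilinear form. -/
def Metric.bilin (p : M) : LinearMap.BilinForm ℝ (Tan E p) :=
  LinearMap.mk₂ ℝ (fun v w => g.val p v w) (by simp) (by simp) (by simp) (by simp)

/-- The orthogonal distribution `D^⊥`. -/
def perp (D : Dist E M) : Dist E M := fun p => (g.bilin p).orthogonal (D p)

/-- `D` is nondegenerate: the restriction of the metric to `D` is nondegenerate at each point. -/
def IsNondegenerate (D : Dist E M) : Prop :=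
  ∀ p, ∀ v ∈ D p, (∀ w ∈ D p, g.val p v w = 0) → v = 0

open Classical in
/-- The orthogonal projection `v ↦ v^D` of the splitting `TM = D ⊕ D^⊥`, for nondegenerate `D`. -/
def proj (D : Dist E M) (p : M) : Tan E p →ₗ[ℝ] Tan E p :=
  if h : IsCompl (D p) (perp g D p) then Submodule.projection (D p) (perp g D p) h else 0

variable [FiniteDimensional ℝ E]

/-- The generalized second fundamental form `s^D(X, Y) = (∇_X Y)^{D^⊥}`. -/
def secondForm (D : Dist E M) (X Y : ∀ p : M, Tan E p) (p : M) : Tan E p :=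
  proj g (perp g D) p (nabla g X Y p)

/-- The symmetric part `h^D(X, Y)` of `s^D(X, Y)`. -/
def symSecondForm (D : Dist E M) (X Y : ∀ p : M, Tan E p) (p : M) : Tan E p :=
  (1 / 2 : ℝ) • (secondForm g D X Y p + secondForm g D Y X p)

/-- `H` is the mean curvature normal of `D`: the section of `D^⊥` that satisfies
`m • H = tr h^D`, where `m` is the rank of `D`. The trace is taken in arbitrary orthogonal bases of
`D_p` that are made of values of sections of `D`. -/
structure IsMeanCurvatureNormal (D : Dist E M) (H : ∀ p : M, Tan E p) : Prop where
  isSection : IsSection (perp g D) H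
  trace_eq : ∀ (p : M) (X : Fin (Module.finrank ℝ (D p)) → ∀ q : M, Tan E q),
    (∀ a, IsSection D (X a)) →
    (∀ a b, a ≠ b → g.val p (X a p) (X b p) = 0) →
    (∀ a, g.val p (X a p) (X a p) ≠ 0) →
    (Module.finrank ℝ (D p) : ℝ) • H p =
      ∑ a, (g.val p (X a p) (X a p))⁻¹ • symSecondForm g D (X a) (X a) p

/-- `D` is geodesic: `s^D(X, Y) = 0` for all `X, Y ∈ Γ(D)`. -/
structure IsGeodesic (D : Dist E M) : Prop where
  nondegenerate : IsNondegenerate g D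
  secondForm_eq : ∀ X Y, IsSection D X → IsSection D Y → ∀ p, secondForm g D X Y p = 0

/-- `D` is umbilical with mean curvature normal `H`: `s^D(X, Y) = ⟨X, Y⟩ H` for all
`X, Y ∈ Γ(D)`. -/
structure IsUmbilicalWith (D : Dist E M) (H : ∀ p : M, Tan E p) : Prop where
  nondegenerate : IsNondegenerate g D
  meanCurvature : IsMeanCurvatureNormal g D H
  secondForm_eq : ∀ X Y, IsSection D X → IsSection D Y →
    ∀ p, secondForm g D X Y p = g.val p (X p) (Y p) • H p

/-- `D` is spherical: `D` is umbilical and its mean curvature normal `H` satisfies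
`(∇_X H)^{D^⊥} = 0` for all `X ∈ Γ(D)`. -/
def IsSpherical (D : Dist E M) : Prop :=
  ∃ H : ∀ p : M, Tan E p, IsUmbilicalWith g D H ∧
    ∀ X, IsSection D X → ∀ p, proj g (perp g D) p (nabla g X H p) = 0

/-- `D` is Killing: `D` is spherical and `D^⊥` is geodesic. -/
def IsKilling (D : Dist E M) : Prop :=
  IsSpherical g D ∧ IsGeodesic g (perp g D)

end Distributions

/-- The function `f` is independent of the distribution `D`: `df` vanishes on `D`. -/
def IndependentOf (f : M → ℝ) (D : Dist E M) : Prop :=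
  ∀ p, ∀ v ∈ D p, diff E f p v = 0

/-- The family `(D i)` is locally a product: around each point there are local coordinates with
values in a product of open sets `U i` of Euclidean spaces, in which `D i` is tangent to the slices
along the `i`-th factor. Equivalently, a neighbourhood of each point is diffeomorphic to a product
manifold whose slices are integral manifolds of the `D i`. -/
def IsLocallyProduct {ι : Type*} [Fintype ι] (D : ι → Dist E M) : Prop :=
  ∀ p : M, ∃ (d : ι → ℕ)
    (φ : OpenPartialHomeomorph M (∀ i, EuclideanSpace ℝ (Fin (d i))))
    (U : ∀ i, Set (EuclideanSpace ℝ (Fin (d i)))),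
    p ∈ φ.source ∧ (∀ i, IsOpen (U i)) ∧ φ.target = Set.univ.pi U ∧
    ContMDiffOn 𝓘(ℝ, E) 𝓘(ℝ, ∀ i, EuclideanSpace ℝ (Fin (d i))) ∞ φ φ.source ∧
    ContMDiffOn 𝓘(ℝ, ∀ i, EuclideanSpace ℝ (Fin (d i))) 𝓘(ℝ, E) ∞ φ.symm φ.target ∧
    ∀ q ∈ φ.source, ∀ i, ∀ v : Tan E q,
      v ∈ D i q ↔ ∀ j, j ≠ i → mvfderiv 𝓘(ℝ, E) (fun x => φ x j) q v = 0

/-- The family `(D i)` is orthogonally integrable: it consists of nondegenerate distributions, `TM`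
is their orthogonal direct sum, and it is locally a product. -/
structure IsOrthogonallyIntegrable {ι : Type*} [Fintype ι] (g : Metric E M) (D : ι → Dist E M) :
    Prop where
  nondegenerate : ∀ i, IsNondegenerate g (D i)
  orthogonal : ∀ p i j, i ≠ j → ∀ v ∈ D i p, ∀ w ∈ D j p, g.val p v w = 0
  independent : ∀ p, iSupIndep fun i => D i p
  span : ∀ p, ⨆ i, D i p = ⊤
  product : IsLocallyProduct D

/-! ### Conformal Killing tensors -/

section Killing

/-- The Schouten bracket `[K, L]` of two symmetric contravariant `2`-tensor fields, evaluated on the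
differentials of three functions. In local coordinates it is the symmetrization of
`2 K^{il} ∂_l L^{jk} - 2 L^{il} ∂_l K^{jk}`: the terms with second derivatives of the functions
cancel. -/
def schouten (K L : ∀ p : M, Cotan E p →L[ℝ] Tan E p) (f₁ f₂ f₃ : M → ℝ) (p : M) : ℝ :=
  let term (a b c : M → ℝ) : ℝ :=
    2 * diff E (fun q => diff E c q (L q (diff E b q))) p (K p (diff E a p))
      - 2 * diff E (fun q => diff E c q (K q (diff E b q))) p (L p (diff E a p))
  (1 / 3 : ℝ) * (term f₁ f₂ f₃ + term f₂ f₃ f₁ + term f₃ f₁ f₂)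

/-- The symmetric product `C ⊙ L` of a vector and a symmetric contravariant `2`-tensor at `p`. -/
def symProd {p : M} (C : Tan E p) (L : Cotan E p →L[ℝ] Tan E p) (α β γ : Cotan E p) : ℝ :=
  (1 / 3 : ℝ) * (α C * γ (L β) + β C * α (L γ) + γ C * β (L α))

variable [FiniteDimensional ℝ E] (g : Metric E M) (T : SymTensor E M)

/-- `T` is a conformal Killing tensor with conformal factor `t`: `[T, G] = -2 t ⊙ G`, where `G` is
the contravariant metric. -/
structure IsConformalKilling (t : ∀ p : M, Tan E p) : Prop where
  smooth : SmoothField t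
  schouten_eq : ∀ f₁ f₂ f₃ : M → ℝ, SmoothFun E f₁ → SmoothFun E f₂ → SmoothFun E f₃ → ∀ p,
    schouten T.val g.sharp f₁ f₂ f₃ p =
      -2 * symProd (t p) (g.sharp p) (diff E f₁ p) (diff E f₂ p) (diff E f₃ p)

/-- `T` is a Killing tensor: a conformal Killing tensor with conformal factor zero. -/
def IsKillingTensor : Prop := IsConformalKilling g T 0

/-- The endomorphism of the tangent space determined by `T`: lower an index, then apply `T`. -/
def SymTensor.endo (p : M) : Module.End ℝ (Tan E p) :=
  (T.val p).toLinearMap ∘ₗ (g.flat p).toLinearMap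

/-- The eigenspace distribution `ker (T - μ I)` of a function `μ`. -/
def eigenDist (μ : M → ℝ) : Dist E M := fun p => Module.End.eigenspace (T.endo g p) (μ p)

/-- `T` is an orthogonal tensor (its endomorphism is pointwise diagonalizable with real eigenvalues)
whose eigenfunctions are the smooth functions `lam i`: at each point these are its eigenvalues,
each listed once. -/
structure IsOrthogonalTensor {ι : Type*} (lam : ι → M → ℝ) : Prop where
  smooth : ∀ i, SmoothFun E (lam i)
  distinct : ∀ p i j, i ≠ j → lam i p ≠ lam j p
  eigenvalue : ∀ p i, Module.End.HasEigenvalue (T.endo g p) (lam i p)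
  diagonalizable : ∀ p, ⨆ i, eigenDist g T (lam i) p = ⊤

end Killing

end PseudoRiemannian

end

/-!
Let `X`, `Y` be sections of an eigenspace `E_i`. Then `(∇_X T) Y = dλ_i(X) Y + (λ_i - T) ∇_X Y`, so
the component of `∇_X Y` in `E_j` can be read off from `∇T`. Applied to gradients, the conformal
Killing equation says that the cyclic sum of `⟨(∇_X T) Y, Z⟩` is that of `⟨t, X⟩ ⟨Y, Z⟩`. On `E_i`
this gives `dλ_i = ⟨t, ·⟩`. For `X`, `Y` in `E_i` and `Z` in `E_j` it gives
`2 (λ_i - λ_j) ⟨∇_X Y, Z⟩ = ⟨X, Y⟩ (dλ_j - dλ_i)(Z)`. Hence `E_i` is umbilical, and the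
`E_j`-component of its mean curvature normal is that of the gradient of
`u_ij = -½ log |λ_i - λ_j|`.

By integrability `⟨∇_X Y, Z⟩ = 0` for sections of three different eigenspaces. So `E_i` is geodesic
iff all `u_ij` are constant along the `E_j`, and the orthogonal complement of `E_i` is geodesic iff
all `u_ij` are constant along `E_i`. In the latter case `E_i` is automatically spherical, by the
symmetry of the Hessian of `u_ij`. As `dλ_i = ⟨t, ·⟩` on `E_i`, these conditions are the stated
equations between gradients and `t`.
-/

noncomputable section

namespace PseudoRiemannian

section BundleInverse

variable {𝕜 : Type*} [NontriviallyNormedField 𝕜] {n : WithTop ℕ∞}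
  {EB : Type*} [NormedAddCommGroup EB] [NormedSpace 𝕜 EB]
  {H : Type*} [TopologicalSpace H] {I : ModelWithCorners 𝕜 EB H}
  {B : Type*} [TopologicalSpace B] [ChartedSpace H B]
  {F₁ : Type*} [NormedAddCommGroup F₁] [NormedSpace 𝕜 F₁] [CompleteSpace F₁]
  {V₁ : B → Type*} [TopologicalSpace (TotalSpace F₁ V₁)] [∀ x, AddCommGroup (V₁ x)]
  [∀ x, Module 𝕜 (V₁ x)] [∀ x, TopologicalSpace (V₁ x)] [FiberBundle F₁ V₁]
  [VectorBundle 𝕜 F₁ V₁] [∀ x, IsTopologicalAddGroup (V₁ x)] [∀ x, ContinuousSMul 𝕜 (V₁ x)]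
  {F₂ : Type*} [NormedAddCommGroup F₂] [NormedSpace 𝕜 F₂]
  {V₂ : B → Type*} [TopologicalSpace (TotalSpace F₂ V₂)] [∀ x, AddCommGroup (V₂ x)]
  [∀ x, Module 𝕜 (V₂ x)] [∀ x, TopologicalSpace (V₂ x)] [FiberBundle F₂ V₂]
  [VectorBundle 𝕜 F₂ V₂] [∀ x, IsTopologicalAddGroup (V₂ x)] [∀ x, ContinuousSMul 𝕜 (V₂ x)]

theorem contMDiffAt_hom_bundle_symm {L : ∀ x, V₁ x ≃L[𝕜] V₂ x} {x₀ : B}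
    (hL : ContMDiffAt I (I.prod 𝓘(𝕜, F₁ →L[𝕜] F₂)) n
      (fun x => TotalSpace.mk' (F₁ →L[𝕜] F₂) x (L x : V₁ x →L[𝕜] V₂ x) :
        B → TotalSpace (F₁ →L[𝕜] F₂) (fun x => V₁ x →L[𝕜] V₂ x)) x₀) :
    ContMDiffAt I (I.prod 𝓘(𝕜, F₂ →L[𝕜] F₁)) n
      (fun x => TotalSpace.mk' (F₂ →L[𝕜] F₁) x ((L x).symm : V₂ x →L[𝕜] V₁ x) :
        B → TotalSpace (F₂ →L[𝕜] F₁) (fun x => V₂ x →L[𝕜] V₁ x)) x₀ := by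
  rw [contMDiffAt_hom_bundle] at hL ⊢
  refine ⟨contMDiffAt_id, ?_⟩
  let e₁ := trivializationAt F₁ V₁ x₀
  let e₂ := trivializationAt F₂ V₂ x₀
  have h₁ : x₀ ∈ e₁.baseSet := FiberBundle.mem_baseSet_trivializationAt' x₀
  have h₂ : x₀ ∈ e₂.baseSet := FiberBundle.mem_baseSet_trivializationAt' x₀
  let A (x : B) (hx₁ : x ∈ e₁.baseSet) (hx₂ : x ∈ e₂.baseSet) : F₁ ≃L[𝕜] F₂ :=
    ((e₁.continuousLinearEquivAt 𝕜 x hx₁).symm.trans (L x)).trans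
      (e₂.continuousLinearEquivAt 𝕜 x hx₂)
  let C (x : B) : F₁ →L[𝕜] F₂ :=
    ContinuousLinearMap.inCoordinates F₁ V₁ F₂ V₂ x₀ x x₀ x (L x : V₁ x →L[𝕜] V₂ x)
  have coord_eq (x : B) (hx₁ : x ∈ e₁.baseSet) (hx₂ : x ∈ e₂.baseSet) : C x = A x hx₁ hx₂ :=
    ContinuousLinearMap.inCoordinates_eq hx₁ hx₂
  have coord_symm_eq (x : B) (hx₁ : x ∈ e₁.baseSet) (hx₂ : x ∈ e₂.baseSet) :
      ContinuousLinearMap.inCoordinates F₂ V₂ F₁ V₁ x₀ x x₀ x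
        ((L x).symm : V₂ x →L[𝕜] V₁ x) = ((A x hx₁ hx₂).symm : F₂ →L[𝕜] F₁) :=
    ContinuousLinearMap.inCoordinates_eq hx₂ hx₁
  have inverse_smooth : ContDiffAt 𝕜 n ContinuousLinearMap.inverse (C x₀) := by
    rw [coord_eq x₀ h₁ h₂]
    exact contDiffAt_map_inverse _
  refine (inverse_smooth.comp_contMDiffAt (f := C) hL.2).congr_of_eventuallyEq ?_
  filter_upwards [e₁.open_baseSet.mem_nhds h₁, e₂.open_baseSet.mem_nhds h₂] with x hx₁ hx₂
  rw [Function.comp_apply, coord_eq x hx₁ hx₂, ContinuousLinearMap.inverse_equiv]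
  exact coord_symm_eq x hx₁ hx₂

end BundleInverse

variable {E : Type*} [NormedAddCommGroup E] [NormedSpace ℝ E]
  {M : Type*} [TopologicalSpace M] [ChartedSpace E M]

section SmoothFields

theorem diff_congr {f f' : M → ℝ} {p : M} (h : f =ᶠ[𝓝 p] f') : diff E f p = diff E f' p := by
  ext v
  simp only [diff, mvfderiv]
  rw [h.mfderiv_eq, h.eq_of_nhds]

variable [IsManifold 𝓘(ℝ, E) ∞ M]

/-- The vector field `X` is smooth at `p`. -/
abbrev SmoothFieldAt (X : ∀ p : M, Tan E p) (p : M) : Prop :=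
  ContMDiffAt 𝓘(ℝ, E) (𝓘(ℝ, E).prod 𝓘(ℝ, E)) ∞
    (fun q => TotalSpace.mk' E q (X q) : M → TotalSpace E (TangentSpace 𝓘(ℝ, E) : M → Type _)) p

theorem contMDiffAt_diff {f : M → ℝ} {p : M} (hf : ContMDiffAt 𝓘(ℝ, E) 𝓘(ℝ, ℝ) ∞ f p) :
    ContMDiffAt 𝓘(ℝ, E) (𝓘(ℝ, E).prod 𝓘(ℝ, E →L[ℝ] ℝ)) ∞
      (fun q => TotalSpace.mk' (E →L[ℝ] ℝ) q (diff E f q) :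
        M → TotalSpace (E →L[ℝ] ℝ) (fun q : M => TangentSpace 𝓘(ℝ, E) q →L[ℝ] ℝ)) p := by
  refine (contMDiffAt_hom_bundle (E₂ := Bundle.Trivial M ℝ) _).2 ⟨contMDiffAt_id, ?_⟩
  refine (hf.mfderiv_const (m := ∞) (by simp)).congr_of_eventuallyEq (.of_forall fun q => ?_)
  ext v
  simp only [ContinuousLinearMap.inCoordinates, Trivial.fiberBundle_trivializationAt',
    Trivial.continuousLinearMapAt_trivialization, mvfderiv, ContinuousLinearMap.id_comp,
    ContinuousLinearMap.comp_apply, ContinuousLinearEquiv.coe_coe, inTangentCoordinates,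
    TangentBundle.continuousLinearMapAt_model_space, id_eq]
  rfl

theorem contMDiffAt_diff_apply {f : M → ℝ} {X : ∀ p : M, Tan E p} {p : M}
    (hf : ContMDiffAt 𝓘(ℝ, E) 𝓘(ℝ, ℝ) ∞ f p) (hX : SmoothFieldAt X p) :
    ContMDiffAt 𝓘(ℝ, E) 𝓘(ℝ, ℝ) ∞ (fun q => diff E f q (X q)) p := by
  have h := ContMDiffAt.clm_bundle_apply (E₂ := Bundle.Trivial M ℝ) (contMDiffAt_diff hf) hX
  rw [contMDiffAt_totalSpace] at h
  exact h.2

theorem SmoothField.diffFieldAt {X : ∀ p : M, Tan E p} (h : SmoothField X) (p : M) :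
    DiffFieldAt X p :=
  (h p).mdifferentiableAt (by simp)

instance {n : WithTop ℕ∞} [ENat.LEInfty n] : IsManifold 𝓘(ℝ, E) (minSmoothness ℝ n) M := by
  rw [minSmoothness_of_isRCLikeNormedField]
  infer_instance

theorem SmoothFieldAt.mlieBracket [CompleteSpace E] {X Y : ∀ p : M, Tan E p} {p : M}
    (hX : SmoothFieldAt X p) (hY : SmoothFieldAt Y p) :
    SmoothFieldAt (VectorField.mlieBracket 𝓘(ℝ, E) X Y) p := by
  have : IsManifold 𝓘(ℝ, E) ((⊤ : ℕ∞) + 1) M := ‹IsManifold 𝓘(ℝ, E) ∞ M›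
  exact hX.mlieBracket_vectorField (n := ⊤) hY (by simp)

theorem mlieBracket_mlieBracket_smul_right [CompleteSpace E] {f : M → ℝ}
    {X Y Z : ∀ p : M, Tan E p} {p : M} (hf : ContMDiffAt 𝓘(ℝ, E) 𝓘(ℝ, ℝ) ∞ f p)
    (hY : SmoothFieldAt Y p) (hZ : SmoothFieldAt Z p) :
    VectorField.mlieBracket 𝓘(ℝ, E) X (VectorField.mlieBracket 𝓘(ℝ, E) Y (f • Z)) p =
      diff E (fun q => diff E f q (Y q)) p (X p) • Z p
        + diff E f p (Y p) • VectorField.mlieBracket 𝓘(ℝ, E) X Z p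
        + (diff E f p (X p) • VectorField.mlieBracket 𝓘(ℝ, E) Y Z p
          + f p • VectorField.mlieBracket 𝓘(ℝ, E) X (VectorField.mlieBracket 𝓘(ℝ, E) Y Z) p) := by
  have inner_bracket : VectorField.mlieBracket 𝓘(ℝ, E) Y (f • Z) =ᶠ[𝓝 p]
      (fun q => diff E f q (Y q)) • Z + f • VectorField.mlieBracket 𝓘(ℝ, E) Y Z := by
    filter_upwards [(contMDiffAt_iff_contMDiffAt_nhds (by simp)).1 (hf.of_le (m := 1) (by simp)),
      (contMDiffAt_iff_contMDiffAt_nhds (by simp)).1 (hZ.of_le (m := 1) (by simp))] with q hfq hZq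
    exact VectorField.mlieBracket_smul_right (hfq.mdifferentiableAt one_ne_zero)
      (hZq.mdifferentiableAt one_ne_zero)
  have hf' := hf.mdifferentiableAt (by simp)
  have hZ' := hZ.mdifferentiableAt (by simp)
  have hYf := (contMDiffAt_diff_apply hf hY).mdifferentiableAt (by simp)
  have hYZ := (hY.mlieBracket hZ).mdifferentiableAt (by simp)
  rw [(Filter.EventuallyEq.refl (𝓝 p) X).mlieBracket_vectorField_eq inner_bracket,
    VectorField.mlieBracket_add_right (hYf.smul_section hZ') (hf'.smul_section hYZ),
    VectorField.mlieBracket_smul_right hYf hZ', VectorField.mlieBracket_smul_right hf' hYZ]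

/-- The identity is the coefficient of `Z p` in the Jacobi identity for `X`, `Y` and `f • Z`. -/
theorem diff_mlieBracket [CompleteSpace E] {f : M → ℝ} {X Y : ∀ p : M, Tan E p} {p : M}
    (hf : ContMDiffAt 𝓘(ℝ, E) 𝓘(ℝ, ℝ) ∞ f p) (hX : SmoothFieldAt X p) (hY : SmoothFieldAt Y p) :
    diff E f p (VectorField.mlieBracket 𝓘(ℝ, E) X Y p) =
      diff E (fun q => diff E f q (Y q)) p (X p) - diff E (fun q => diff E f q (X q)) p (Y p) := by
  have smul_eq_zero_of_coeff (z : Tan E p) :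
      (diff E f p (VectorField.mlieBracket 𝓘(ℝ, E) X Y p) -
        (diff E (fun q => diff E f q (Y q)) p (X p) -
          diff E (fun q => diff E f q (X q)) p (Y p))) • z = 0 := by
    set Z : ∀ q : M, Tan E q := FiberBundle.extend E z
    have hZ : SmoothFieldAt Z p := FiberBundle.contMDiffAt_extend ..
    have hle : minSmoothness ℝ 2 ≤ ∞ := by
      rw [minSmoothness_of_isRCLikeNormedField]
      exact ENat.LEInfty.out
    have hf' := hf.mdifferentiableAt (by simp)
    have jacobi_smul := VectorField.leibniz_identity_mlieBracket_apply (hX.of_le hle)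
      (hY.of_le hle) ((hf.smul_section hZ).of_le hle)
    have jacobi := VectorField.leibniz_identity_mlieBracket_apply (hX.of_le hle)
      (hY.of_le hle) (hZ.of_le hle)
    rw [mlieBracket_mlieBracket_smul_right hf hY hZ,
      mlieBracket_mlieBracket_smul_right hf hX hZ,
      VectorField.mlieBracket_smul_right hf' (hZ.mdifferentiableAt (by simp)), jacobi]
      at jacobi_smul
    have hz : Z p = z := by simp [Z]
    rw [← hz]
    refine Eq.trans ?_ (sub_eq_zero.2 jacobi_smul.symm)
    module
  by_contra hne
  have eq_zero (z : Tan E p) : z = 0 :=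
    (smul_eq_zero.1 (smul_eq_zero_of_coeff z)).resolve_left (sub_ne_zero.2 hne)
  exact hne (by simp only [eq_zero (VectorField.mlieBracket 𝓘(ℝ, E) X Y p), eq_zero (X p),
    eq_zero (Y p), map_zero, sub_zero])

end SmoothFields

section Gradient

variable [IsManifold 𝓘(ℝ, E) ∞ M]

theorem isLocallyConstant_of_diff_eq_zero {f : M → ℝ} (hf : SmoothFun E f)
    (h : ∀ p, diff E f p = 0) : IsLocallyConstant f := by
  rw [IsLocallyConstant.iff_eventually_eq]
  intro p
  set φ := extChartAt 𝓘(ℝ, E) p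
  have chart_deriv : ∀ y ∈ φ.target, HasFDerivAt (f ∘ φ.symm) (0 : E →L[ℝ] ℝ) y := by
    intro y hy
    have hφ := mdifferentiableWithinAt_extChartAt_symm (I := 𝓘(ℝ, E)) hy
    rw [modelWithCornersSelf_coe, range_id, mdifferentiableWithinAt_univ] at hφ
    have hf' := hf.mdifferentiable (by simp) (φ.symm y)
    have hcomp := (hf'.hasMFDerivAt.comp y hφ.hasMFDerivAt).hasFDerivAt
    have diff_comp : (0 : E →L[ℝ] ℝ) =
        (mfderiv% f (φ.symm y)).comp (mfderiv% φ.symm y) := by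
      ext v
      exact (DFunLike.congr_fun (h (φ.symm y)) (mfderiv% φ.symm y v)).symm
    exact diff_comp ▸ hcomp
  have isOpen_level : IsOpen (φ.target ∩ (f ∘ φ.symm) ⁻¹' {f p}) :=
    (isOpen_extChartAt_target p).isOpen_inter_preimage_of_fderiv_eq_zero
      (fun y hy => (chart_deriv y hy).differentiableAt.differentiableWithinAt)
      (fun y hy => (chart_deriv y hy).fderiv) _
  have mem_level : φ p ∈ φ.target ∩ (f ∘ φ.symm) ⁻¹' {f p} :=
    ⟨mem_extChartAt_target p, congrArg f (extChartAt_to_inv p)⟩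
  filter_upwards [(continuousAt_extChartAt p).preimage_mem_nhds (isOpen_level.mem_nhds mem_level),
    extChartAt_source_mem_nhds (I := 𝓘(ℝ, E)) p] with q hq hqs
  have hlevel : f (φ.symm (φ q)) = f p := hq.2
  rwa [φ.left_inv hqs] at hlevel

variable [FiniteDimensional ℝ E]

theorem exists_smoothFun_diff_eq [T2Space M] (p : M) (α : Cotan E p) :
    ∃ f : M → ℝ, SmoothFun E f ∧ diff E f p = α := by
  obtain ⟨χ⟩ : Nonempty (SmoothBumpFunction 𝓘(ℝ, E) p) := inferInstance
  let α' : E →L[ℝ] ℝ := α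
  have near_p : (fun q => χ q • α' (extChartAt 𝓘(ℝ, E) p q)) =ᶠ[𝓝 p]
      α' ∘ extChartAt 𝓘(ℝ, E) p := by
    filter_upwards [χ.eventuallyEq_one] with q hq
    simp [hq]
  have chart_diff : MDifferentiableAt 𝓘(ℝ, E) 𝓘(ℝ, E) (extChartAt 𝓘(ℝ, E) p) p :=
    mdifferentiableAt_extChartAt (mem_chart_source E p)
  refine ⟨fun q => χ q • α' (extChartAt 𝓘(ℝ, E) p q),
    χ.contMDiff_smul (α'.contMDiff.comp_contMDiffOn contMDiffOn_extChartAt), ?_⟩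
  ext v
  rw [diff_congr near_p, diff, mvfderiv_comp_apply p
    (α'.contMDiff.contMDiffAt.mdifferentiableAt one_ne_zero) chart_diff, mfderiv_extChartAt_self,
    mvfderiv, mfderiv_eq_fderiv, α'.fderiv]
  rfl

namespace Metric

variable (g : Metric E M)

theorem val_grad (f : M → ℝ) (p : M) (v : Tan E p) : g.val p (g.grad f p) v = diff E f p v :=
  g.val_sharp p _ v

theorem contMDiffAt_sharp (p : M) :
    ContMDiffAt 𝓘(ℝ, E) (𝓘(ℝ, E).prod 𝓘(ℝ, (E →L[ℝ] ℝ) →L[ℝ] E)) ∞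
      (fun q => TotalSpace.mk' ((E →L[ℝ] ℝ) →L[ℝ] E) q (g.sharp q) :
        M → TotalSpace ((E →L[ℝ] ℝ) →L[ℝ] E)
          (fun q : M => (TangentSpace 𝓘(ℝ, E) q →L[ℝ] ℝ) →L[ℝ] TangentSpace 𝓘(ℝ, E) q)) p := by
  have := FiniteDimensional.complete ℝ E
  exact contMDiffAt_hom_bundle_symm (L := fun q => (g.flat q).toContinuousLinearEquiv)
    (g.smooth p)

theorem smoothField_grad {f : M → ℝ} (hf : SmoothFun E f) : SmoothField (g.grad f) :=
  fun p => ContMDiffAt.clm_bundle_apply (g.contMDiffAt_sharp p) (contMDiffAt_diff (hf p))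

theorem exists_grad_eq [T2Space M] (p : M) (v : Tan E p) :
    ∃ f : M → ℝ, SmoothFun E f ∧ g.grad f p = v := by
  obtain ⟨f, hf, hfv⟩ := exists_smoothFun_diff_eq p (g.val p v)
  refine ⟨f, hf, g.flat_injective p ?_⟩
  ext w
  rw [val_grad, hfv]

end Metric

namespace SymTensor

variable (g : Metric E M) (T : SymTensor E M)

theorem smoothFieldAt_endo {X : ∀ p : M, Tan E p} {p : M} (hX : SmoothFieldAt X p) :
    SmoothFieldAt (fun q => T.endo g q (X q)) p :=
  ContMDiffAt.clm_bundle_apply (T.smooth p) (ContMDiffAt.clm_bundle_apply (g.smooth p) hX)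

theorem diffFieldAt_endo {X : ∀ p : M, Tan E p} {p : M} (hX : DiffFieldAt X p) :
    DiffFieldAt (fun q => T.endo g q (X q)) p :=
  MDifferentiableAt.clm_bundle_apply (T.smooth.mdifferentiable (by simp) p)
    (MDifferentiableAt.clm_bundle_apply (g.smooth.mdifferentiable (by simp) p) hX)

theorem val_endo_comm (p : M) (v w : Tan E p) :
    g.val p (T.endo g p v) w = g.val p v (T.endo g p w) := by
  rw [g.symm p _ w]
  exact T.symm p (g.val p v) (g.val p w)

end SymTensor

end Gradient

section LeviCivitaConnection

variable [IsManifold 𝓘(ℝ, E) ∞ M] {g : Metric E M}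

theorem diff_val_eq_zero {Y Z : ∀ p : M, Tan E p} (h : ∀ q, g.val q (Y q) (Z q) = 0) (p : M) :
    diff E (fun q => g.val q (Y q) (Z q)) p = 0 := by
  simp only [h]
  rw [diff, mvfderiv_const]

variable [FiniteDimensional ℝ E]

theorem tensorialAt_nabla {Y : ∀ p : M, Tan E p} {p : M} (hY : DiffFieldAt Y p) :
    TensorialAt 𝓘(ℝ, E) E (fun X => nabla g X Y p) p where
  smul {f X} hf hX := by
    refine eq_of_forall_field (g := g) fun Z hZ => ?_
    rw [map_smul, smul_apply, nabla_koszul hX hY hZ,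
      nabla_koszul (hf.smul_section hX) hY hZ]
    simp only [koszul, diff, Pi.smul_apply', map_smul, smul_apply, smul_eq_mul]
    rw [VectorField.mlieBracket_smul_right hf hX, VectorField.mlieBracket_smul_left hf hX]
    have diff_ZX := mvfderiv_mul hf (mdifferentiableAt_metric (g := g) hZ hX)
    have diff_XY := mvfderiv_mul hf (mdifferentiableAt_metric (g := g) hX hY)
    simp only [Pi.mul_def] at diff_ZX diff_XY
    rw [diff_ZX, diff_XY]
    simp only [map_add, map_smul, add_apply, smul_apply, smul_eq_mul, map_neg, neg_apply,
      neg_smul]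
    rw [g.symm p (X p) (Z p)]
    ring
  add {X X'} hX hX' := by
    refine eq_of_forall_field (g := g) fun Z hZ => ?_
    rw [map_add, add_apply, nabla_koszul hX hY hZ, nabla_koszul hX' hY hZ,
      nabla_koszul (mdifferentiableAt_add_section hX hX') hY hZ]
    simp only [koszul, diff, Pi.add_apply, map_add, add_apply]
    rw [VectorField.mlieBracket_add_right hX hX', VectorField.mlieBracket_add_left hX hX']
    have diff_ZX := mvfderiv_add (mdifferentiableAt_metric (g := g) hZ hX)
      (mdifferentiableAt_metric (g := g) hZ hX')
    have diff_XY := mvfderiv_add (mdifferentiableAt_metric (g := g) hX hY)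
      (mdifferentiableAt_metric (g := g) hX' hY)
    simp only [Pi.add_def] at diff_ZX diff_XY
    rw [diff_ZX, diff_XY]
    simp only [map_add, add_apply]
    ring

theorem nabla_eq_nabla_add_mlieBracket {X Y : ∀ p : M, Tan E p} {p : M}
    (hX : DiffFieldAt X p) (hY : DiffFieldAt Y p) :
    nabla g X Y p = nabla g Y X p + VectorField.mlieBracket 𝓘(ℝ, E) X Y p := by
  rw [← nabla_torsion_free (g := g) hX hY, add_sub_cancel]

theorem nabla_add_right {X Y Y' : ∀ p : M, Tan E p} {p : M}
    (hX : DiffFieldAt X p) (hY : DiffFieldAt Y p) (hY' : DiffFieldAt Y' p) :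
    nabla g X (Y + Y') p = nabla g X Y p + nabla g X Y' p := by
  rw [nabla_eq_nabla_add_mlieBracket hX (mdifferentiableAt_add_section hY hY'),
    nabla_eq_nabla_add_mlieBracket hX hY, nabla_eq_nabla_add_mlieBracket hX hY',
    (tensorialAt_nabla hX).add hY hY', VectorField.mlieBracket_add_right hY hY']
  module

theorem nabla_smul_right {f : M → ℝ} {X Y : ∀ p : M, Tan E p} {p : M}
    (hf : MDifferentiableAt 𝓘(ℝ, E) 𝓘(ℝ, ℝ) f p)
    (hX : DiffFieldAt X p) (hY : DiffFieldAt Y p) :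
    nabla g X (f • Y) p = diff E f p (X p) • Y p + f p • nabla g X Y p := by
  rw [nabla_eq_nabla_add_mlieBracket hX (hf.smul_section hY),
    nabla_eq_nabla_add_mlieBracket hX hY, (tensorialAt_nabla hX).smul hf hY,
    VectorField.mlieBracket_smul_right hf hY]
  module

theorem val_nabla_grad_comm {f : M → ℝ} (hf : SmoothFun E f) {X Y : ∀ p : M, Tan E p} {p : M}
    (hX : SmoothFieldAt X p) (hY : SmoothFieldAt Y p) :
    g.val p (nabla g X (g.grad f) p) (Y p) = g.val p (nabla g Y (g.grad f) p) (X p) := by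
  have := FiniteDimensional.complete ℝ E
  have hG := (g.smoothField_grad hf).diffFieldAt p
  have hX' := hX.mdifferentiableAt (by simp)
  have hY' := hY.mdifferentiableAt (by simp)
  have metric_X := nabla_metric (g := g) hX' hG hY'
  have metric_Y := nabla_metric (g := g) hY' hG hX'
  simp only [g.val_grad] at metric_X metric_Y
  have commutator := diff_mlieBracket (hf p) hX hY
  rw [← nabla_torsion_free (g := g) hX' hY', map_sub] at commutator
  linarith

theorem val_nabla_of_orthogonal {X Y Z : ∀ p : M, Tan E p} {p : M}
    (hX : DiffFieldAt X p) (hY : DiffFieldAt Y p) (hZ : DiffFieldAt Z p)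
    (h : ∀ q, g.val q (Y q) (Z q) = 0) :
    g.val p (nabla g X Y p) (Z p) = -g.val p (Y p) (nabla g X Z p) := by
  have metric := nabla_metric (g := g) hX hY hZ
  rw [diff_val_eq_zero h, zero_apply] at metric
  linarith

/-- This is the symmetry of the Hessian of `f`, for a field `H` that agrees with `grad f` only along
`Z` and `[X, Z]`. -/
theorem val_nabla_eq_zero_of_val_eq_diff {f : M → ℝ} (hf : SmoothFun E f)
    {X H Z : ∀ p : M, Tan E p} {p : M} (hX : SmoothFieldAt X p) (hH : DiffFieldAt H p)
    (hZ : SmoothFieldAt Z p) (hHZ : ∀ q, g.val q (H q) (Z q) = diff E f q (Z q))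
    (hfX : ∀ q, diff E f q (X q) = 0)
    (hHXZ : g.val p (H p) (VectorField.mlieBracket 𝓘(ℝ, E) X Z p) =
      diff E f p (VectorField.mlieBracket 𝓘(ℝ, E) X Z p))
    (hHX : g.val p (H p) (nabla g Z X p) = 0) :
    g.val p (nabla g X H p) (Z p) = 0 := by
  have := FiniteDimensional.complete ℝ E
  have hX' := hX.mdifferentiableAt (by simp)
  have hZ' := hZ.mdifferentiableAt (by simp)
  have diff_HZ : diff E (fun q => g.val q (H q) (Z q)) p (X p) =
      diff E f p (VectorField.mlieBracket 𝓘(ℝ, E) X Z p) := by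
    have diff_fX : diff E (fun q => diff E f q (X q)) p = 0 := by
      simp only [hfX]
      rw [diff, mvfderiv_const]
    rw [funext hHZ, diff_mlieBracket (hf p) hX hZ, diff_fX, zero_apply, sub_zero]
  have bracket : g.val p (H p) (nabla g X Z p) =
      diff E f p (VectorField.mlieBracket 𝓘(ℝ, E) X Z p) := by
    rw [nabla_eq_nabla_add_mlieBracket hX' hZ', map_add, hHX, zero_add, hHXZ]
  linarith [nabla_metric (g := g) hX' hH hZ']

end LeviCivitaConnection

section CovariantDerivative

variable [IsManifold 𝓘(ℝ, E) ∞ M] [FiniteDimensional ℝ E]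

/-- The covariant derivative `(∇_X T) Y` of `T`, regarded as a field of endomorphisms. -/
def nablaEndo (g : Metric E M) (T : SymTensor E M) (X Y : ∀ p : M, Tan E p) (p : M) : Tan E p :=
  nabla g X (fun q => T.endo g q (Y q)) p - T.endo g p (nabla g X Y p)

variable {g : Metric E M} {T : SymTensor E M}

theorem tensorialAt_nablaEndo_left {Y : ∀ p : M, Tan E p} {p : M} (hY : DiffFieldAt Y p) :
    TensorialAt 𝓘(ℝ, E) E (fun X => nablaEndo g T X Y p) p where
  smul hf hX := by
    rw [nablaEndo, (tensorialAt_nabla hY).smul hf hX,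
      (tensorialAt_nabla (T.diffFieldAt_endo g hY)).smul hf hX, map_smul, ← smul_sub, nablaEndo]
  add hX hX' := by
    rw [nablaEndo, (tensorialAt_nabla hY).add hX hX',
      (tensorialAt_nabla (T.diffFieldAt_endo g hY)).add hX hX', map_add, add_sub_add_comm,
      nablaEndo, nablaEndo]

theorem tensorialAt_nablaEndo_right {X : ∀ p : M, Tan E p} {p : M} (hX : DiffFieldAt X p) :
    TensorialAt 𝓘(ℝ, E) E (fun Y => nablaEndo g T X Y p) p where
  smul {f Y} hf hY := by
    have endo_smul : (fun q => T.endo g q ((f • Y) q)) = f • fun q => T.endo g q (Y q) :=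
      funext fun q => map_smul (T.endo g q) (f q) (Y q)
    rw [nablaEndo, endo_smul, nabla_smul_right hf hX hY,
      nabla_smul_right hf hX (T.diffFieldAt_endo g hY), map_add, map_smul, map_smul, nablaEndo]
    module
  add {Y Y'} hY hY' := by
    have endo_add : (fun q => T.endo g q ((Y + Y') q)) =
        (fun q => T.endo g q (Y q)) + fun q => T.endo g q (Y' q) :=
      funext fun q => map_add (T.endo g q) (Y q) (Y' q)
    rw [nablaEndo, endo_add, nabla_add_right hX hY hY',
      nabla_add_right hX (T.diffFieldAt_endo g hY) (T.diffFieldAt_endo g hY'), map_add,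
      add_sub_add_comm, nablaEndo, nablaEndo]

theorem nablaEndo_congr {X Y X' Y' : ∀ p : M, Tan E p} {p : M}
    (hX : DiffFieldAt X p) (hY : DiffFieldAt Y p) (hX' : DiffFieldAt X' p)
    (hY' : DiffFieldAt Y' p) (hXX' : X p = X' p) (hYY' : Y p = Y' p) :
    nablaEndo g T X Y p = nablaEndo g T X' Y' p :=
  ((tensorialAt_nablaEndo_left hY).pointwise hX hX' hXX').trans
    ((tensorialAt_nablaEndo_right hX').pointwise hY hY' hYY')

theorem nablaEndo_eigenfield {μ : M → ℝ} {X Y : ∀ p : M, Tan E p} {p : M}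
    (hμ : MDifferentiableAt 𝓘(ℝ, E) 𝓘(ℝ, ℝ) μ p) (hX : DiffFieldAt X p) (hY : DiffFieldAt Y p)
    (hTY : ∀ q, T.endo g q (Y q) = μ q • Y q) :
    nablaEndo g T X Y p =
      diff E μ p (X p) • Y p + (μ p • nabla g X Y p - T.endo g p (nabla g X Y p)) := by
  have endo_eq : (fun q => T.endo g q (Y q)) = μ • Y := funext hTY
  rw [nablaEndo, endo_eq, nabla_smul_right hμ hX hY, add_sub_assoc]

theorem SymTensor.val_diff (f : M → ℝ) (p : M) : T.val p (diff E f p) = T.endo g p (g.grad f p) :=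
  congrArg (T.val p) (ContinuousLinearMap.ext fun v => (g.val_grad f p v).symm)

theorem Metric.diff_sharp_diff (f f' : M → ℝ) (p : M) :
    diff E f p (g.sharp p (diff E f' p)) = g.val p (g.grad f p) (g.grad f' p) :=
  (g.val_grad f p _).symm

/-- The left-hand side is half of a term of the Schouten bracket `[T, G]`. The parenthesis on the
right cancels under cyclic summation. -/
theorem schouten_term_eq {a b c : M → ℝ} (ha : SmoothFun E a) (hb : SmoothFun E b)
    (hc : SmoothFun E c) (p : M) :
    diff E (fun q => diff E c q (g.sharp q (diff E b q))) p (T.val p (diff E a p))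
        - diff E (fun q => diff E c q (T.val q (diff E b q))) p (g.sharp p (diff E a p)) =
      -g.val p (nablaEndo g T (g.grad a) (g.grad b) p) (g.grad c p) +
      (g.val p (nabla g (fun q => T.endo g q (g.grad a q)) (g.grad b) p) (g.grad c p)
        + g.val p (nabla g (fun q => T.endo g q (g.grad a q)) (g.grad c) p) (g.grad b p)
        - g.val p (nabla g (fun q => T.endo g q (g.grad c q)) (g.grad b) p) (g.grad a p)
        - g.val p (nabla g (fun q => T.endo g q (g.grad b q)) (g.grad c) p) (g.grad a p)) := by
  have hA := g.smoothField_grad ha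
  have hB := g.smoothField_grad hb
  have hC := g.smoothField_grad hc
  have hTA := T.diffFieldAt_endo g (hA.diffFieldAt p)
  have hTB := T.diffFieldAt_endo g (hB.diffFieldAt p)
  have metric_TA := nabla_metric (g := g) hTA (hC.diffFieldAt p) (hB.diffFieldAt p)
  have metric_A := nabla_metric (g := g) (hA.diffFieldAt p) (hC.diffFieldAt p) hTB
  have hess_b := val_nabla_grad_comm (g := g) hb (hA p) (T.smoothFieldAt_endo g (hC p))
  have hess_c := val_nabla_grad_comm (g := g) hc (hA p) (T.smoothFieldAt_endo g (hB p))
  have diff_apply_eq (f : M → ℝ) (W : ∀ q : M, Tan E q) :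
      (fun q => diff E f q (W q)) = fun q => g.val q (g.grad f q) (W q) :=
    funext fun q => (g.val_grad f q (W q)).symm
  simp only [T.val_diff (g := g), diff_apply_eq]
  change diff E (fun q => g.val q (g.grad c q) (g.grad b q)) p _ - diff E _ p (g.grad a p) = _
  rw [metric_TA, metric_A, g.symm p (g.grad c p), g.symm p (g.grad c p), nablaEndo, map_sub,
    sub_apply, T.val_endo_comm, hess_b, hess_c]
  ring

theorem IsConformalKilling.cyclic_val_nablaEndo_grad {t : ∀ p : M, Tan E p}
    (hT : IsConformalKilling g T t) {a b c : M → ℝ} (ha : SmoothFun E a) (hb : SmoothFun E b)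
    (hc : SmoothFun E c) (p : M) :
    g.val p (nablaEndo g T (g.grad a) (g.grad b) p) (g.grad c p) +
        g.val p (nablaEndo g T (g.grad b) (g.grad c) p) (g.grad a p) +
        g.val p (nablaEndo g T (g.grad c) (g.grad a) p) (g.grad b p) =
      g.val p (t p) (g.grad a p) * g.val p (g.grad b p) (g.grad c p) +
        g.val p (t p) (g.grad b p) * g.val p (g.grad c p) (g.grad a p) +
        g.val p (t p) (g.grad c p) * g.val p (g.grad a p) (g.grad b p) := by
  have bracket := hT.schouten_eq a b c ha hb hc p
  have diff_t (f : M → ℝ) : diff E f p (t p) = g.val p (t p) (g.grad f p) := by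
    rw [g.symm, g.val_grad]
  simp only [schouten, symProd, ← mul_sub, schouten_term_eq ha hb hc p,
    schouten_term_eq hb hc ha p, schouten_term_eq hc ha hb p] at bracket
  simp only [diff_t, g.diff_sharp_diff,
    g.symm p (g.grad c p) (g.grad b p), g.symm p (g.grad b p) (g.grad a p),
    g.symm p (g.grad a p) (g.grad c p)] at bracket
  linarith

theorem IsConformalKilling.cyclic_val_nablaEndo [T2Space M] {t : ∀ p : M, Tan E p}
    (hT : IsConformalKilling g T t) {X Y Z : ∀ p : M, Tan E p} {p : M}
    (hX : DiffFieldAt X p) (hY : DiffFieldAt Y p) (hZ : DiffFieldAt Z p) :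
    g.val p (nablaEndo g T X Y p) (Z p) + g.val p (nablaEndo g T Y Z p) (X p) +
        g.val p (nablaEndo g T Z X p) (Y p) =
      g.val p (t p) (X p) * g.val p (Y p) (Z p) + g.val p (t p) (Y p) * g.val p (Z p) (X p) +
        g.val p (t p) (Z p) * g.val p (X p) (Y p) := by
  obtain ⟨a, ha, haX⟩ := g.exists_grad_eq p (X p)
  obtain ⟨b, hb, hbY⟩ := g.exists_grad_eq p (Y p)
  obtain ⟨c, hc, hcZ⟩ := g.exists_grad_eq p (Z p)
  have hA := (g.smoothField_grad ha).diffFieldAt p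
  have hB := (g.smoothField_grad hb).diffFieldAt p
  have hC := (g.smoothField_grad hc).diffFieldAt p
  have cyclic := hT.cyclic_val_nablaEndo_grad ha hb hc p
  rwa [nablaEndo_congr hA hB hX hY haX hbY, nablaEndo_congr hB hC hY hZ hbY hcZ,
    nablaEndo_congr hC hA hZ hX hcZ haX, haX, hbY, hcZ] at cyclic

end CovariantDerivative

section Projection

variable [IsManifold 𝓘(ℝ, E) ∞ M] {g : Metric E M} {D : Dist E M}

theorem IsSection.diffFieldAt {X : ∀ p : M, Tan E p} (h : IsSection D X) (p : M) :
    DiffFieldAt X p :=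
  h.1.diffFieldAt p

theorem mem_perp {p : M} {w : Tan E p} : w ∈ perp g D p ↔ ∀ v ∈ D p, g.val p v w = 0 :=
  LinearMap.BilinForm.mem_orthogonal_iff

theorem Metric.bilin_isRefl (g : Metric E M) (p : M) : (g.bilin p).IsRefl :=
  fun v w h => (g.symm p w v).trans h

theorem IsNondegenerate.exists_val_ne_zero (hD : IsNondegenerate g D) {p : M}
    {v : Tan E p} (hv : v ∈ D p) (hv0 : v ≠ 0) : ∃ w ∈ D p, g.val p v w ≠ 0 := by
  contrapose! hv0
  exact hD p v hv hv0

theorem IsNondegenerate.linearMap_apply_eq_zero_of_cyclic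
    (hD : IsNondegenerate g D) {p : M} {α : Tan E p →ₗ[ℝ] ℝ}
    (cyclic : ∀ x ∈ D p, ∀ y ∈ D p, ∀ z ∈ D p,
      α x * g.val p y z + α y * g.val p z x + α z * g.val p x y = 0)
    {v : Tan E p} (hv : v ∈ D p) : α v = 0 := by
  by_cases hv0 : v = 0
  · rw [hv0, map_zero]
  obtain ⟨w, hw, hvw⟩ := hD.exists_val_ne_zero hv hv0
  have cyclic_vvw := cyclic v hv v hv w hw
  have cyclic_vvv := cyclic v hv v hv v hv
  rw [g.symm p w v] at cyclic_vvw
  by_cases hvv : g.val p v v = 0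
  · rw [hvv] at cyclic_vvw
    exact (mul_eq_zero.1 (by linarith : α v * g.val p v w = 0)).resolve_right hvw
  · exact (mul_eq_zero.1 (by linarith : α v * g.val p v v = 0)).resolve_right hvv

variable [FiniteDimensional ℝ E]

theorem symSecondForm_self (X : ∀ p : M, Tan E p) (p : M) :
    symSecondForm g D X X p = secondForm g D X X p := by
  rw [symSecondForm]
  module

theorem perp_perp (p : M) : perp g (perp g D) p = D p := by
  refine LinearMap.BilinForm.orthogonal_orthogonal ⟨?_, ?_⟩ (g.bilin_isRefl p) (D p)
  · exact g.nondegenerate p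
  · exact fun w hw => g.nondegenerate p w fun v => (g.symm p w v).trans (hw v)

namespace IsNondegenerate

theorem isCompl_perp (hD : IsNondegenerate g D) (p : M) : IsCompl (D p) (perp g D p) := by
  refine (LinearMap.BilinForm.isCompl_orthogonal_iff_disjoint (g.bilin_isRefl p)).2 ?_
  rw [Submodule.disjoint_def]
  intro v hv hv'
  exact hD p v hv fun w hw => (g.symm p v w).trans (mem_perp.1 hv' w hw)

theorem perp (hD : IsNondegenerate g D) : IsNondegenerate g (perp g D) := by
  intro p v hv h
  have hv' : v ∈ PseudoRiemannian.perp g (PseudoRiemannian.perp g D) p :=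
    mem_perp.2 fun w hw => (g.symm p w v).trans (h w hw)
  rw [perp_perp] at hv'
  exact Submodule.disjoint_def.1 (hD.isCompl_perp p).disjoint v hv' hv

theorem proj_mem (hD : IsNondegenerate g D) (p : M) (v : Tan E p) : proj g D p v ∈ D p := by
  rw [proj, dif_pos (hD.isCompl_perp p)]
  exact Submodule.projection_apply_mem _ v

theorem val_proj (hD : IsNondegenerate g D) {p : M} (v : Tan E p) {w : Tan E p} (hw : w ∈ D p) :
    g.val p (proj g D p v) w = g.val p v w := by
  have sub_mem : v - proj g D p v ∈ PseudoRiemannian.perp g D p := by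
    rw [proj, dif_pos (hD.isCompl_perp p)]
    exact Submodule.sub_projection_mem _ v
  have val_sub := mem_perp.1 sub_mem w hw
  rw [g.symm, map_sub, sub_apply, sub_eq_zero] at val_sub
  exact val_sub.symm

theorem proj_eq_iff (hD : IsNondegenerate g D) {p : M} {v w : Tan E p} (hw : w ∈ D p) :
    proj g D p v = w ↔ ∀ z ∈ D p, g.val p v z = g.val p w z := by
  refine ⟨fun h z hz => by rw [← h, hD.val_proj v hz], fun h => ?_⟩
  rw [← sub_eq_zero]
  refine hD p _ (Submodule.sub_mem _ (hD.proj_mem p v) hw) fun z hz => ?_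
  rw [map_sub, sub_apply, hD.val_proj v hz, h z hz, sub_self]

theorem proj_eq_proj_iff (hD : IsNondegenerate g D) {p : M} {v w : Tan E p} :
    proj g D p v = proj g D p w ↔ ∀ z ∈ D p, g.val p v z = g.val p w z := by
  rw [hD.proj_eq_iff (hD.proj_mem p w)]
  exact forall₂_congr fun z hz => by rw [hD.val_proj w hz]

theorem proj_eq_zero_iff (hD : IsNondegenerate g D) {p : M} {v : Tan E p} :
    proj g D p v = 0 ↔ ∀ z ∈ D p, g.val p v z = 0 := by
  rw [hD.proj_eq_iff (Submodule.zero_mem _)]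
  exact forall₂_congr fun z _ => by rw [map_zero, zero_apply]

theorem proj_of_mem (hD : IsNondegenerate g D) {p : M} {v : Tan E p} (hv : v ∈ D p) :
    proj g D p v = v :=
  (hD.proj_eq_iff hv).2 fun _ _ => rfl

theorem proj_grad_eq_proj_iff (hD : IsNondegenerate g D)
    (f : M → ℝ) {p : M} {v : Tan E p} :
    proj g D p (g.grad f p) = proj g D p v ↔ ∀ z ∈ D p, diff E f p z = g.val p v z := by
  rw [hD.proj_eq_proj_iff]
  exact forall₂_congr fun z _ => by rw [g.val_grad]

theorem secondForm_eq_zero_iff (hD : IsNondegenerate g D) {X Y : ∀ p : M, Tan E p} {p : M} :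
    secondForm g D X Y p = 0 ↔ ∀ z ∈ PseudoRiemannian.perp g D p, g.val p (nabla g X Y p) z = 0 :=
  hD.perp.proj_eq_zero_iff

end IsNondegenerate

/-- A field `D` of subspaces is smooth when the projection onto `D` preserves smooth vector fields.
For nondegenerate `D` this says that `D` is a smooth subbundle of the tangent bundle. -/
def IsSmoothDist (g : Metric E M) (D : Dist E M) : Prop :=
  ∀ X : ∀ p : M, Tan E p, SmoothField X → SmoothField fun p => proj g D p (X p)

theorem IsSmoothDist.exists_isSection [T2Space M] (hD : IsSmoothDist g D)
    (hnd : IsNondegenerate g D) {p : M} {v : Tan E p} (hv : v ∈ D p) :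
    ∃ X, IsSection D X ∧ X p = v := by
  obtain ⟨f, hf, hfv⟩ := g.exists_grad_eq p v
  refine ⟨fun q => proj g D q (g.grad f q),
    ⟨hD _ (g.smoothField_grad hf), fun q => hnd.proj_mem q _⟩, ?_⟩
  exact (congrArg (proj g D p) hfv).trans (hnd.proj_of_mem hv)

end Projection

section Splitting

variable [IsManifold 𝓘(ℝ, E) ∞ M] {ι : Type*}

/-- The tangent bundle is the orthogonal direct sum of the distributions `D i`. The sum is
automatically direct and its summands nondegenerate. -/
structure IsOrthogonalSplitting (g : Metric E M) (D : ι → Dist E M) : Prop where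
  orthogonal : ∀ p i j, i ≠ j → ∀ v ∈ D i p, ∀ w ∈ D j p, g.val p v w = 0
  iSup_eq_top : ∀ p, ⨆ i, D i p = ⊤

namespace IsOrthogonalSplitting

variable {g : Metric E M} {D : ι → Dist E M}

theorem linearMap_eq_zero (hD : IsOrthogonalSplitting g D) {p : M} {F : Type*} [AddCommGroup F]
    [Module ℝ F] {α : Tan E p →ₗ[ℝ] F} (h : ∀ i, ∀ z ∈ D i p, α z = 0) : α = 0 := by
  have range_le : ⨆ i, D i p ≤ LinearMap.ker α := iSup_le fun i z hz => h i z hz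
  rw [hD.iSup_eq_top p, top_le_iff] at range_le
  exact LinearMap.ker_eq_top.1 range_le

theorem eq_of_forall_val_eq (hD : IsOrthogonalSplitting g D) {p : M} {v w : Tan E p}
    (h : ∀ i, ∀ z ∈ D i p, g.val p v z = g.val p w z) : v = w := by
  refine g.flat_injective p (sub_eq_zero.1 (ContinuousLinearMap.coe_injective ?_))
  refine hD.linearMap_eq_zero fun i z hz => ?_
  exact sub_eq_zero.2 (h i z hz)

theorem isNondegenerate (hD : IsOrthogonalSplitting g D) (i : ι) : IsNondegenerate g (D i) := by
  refine fun p v hv h => hD.eq_of_forall_val_eq fun j z hz => ?_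
  rw [map_zero, zero_apply]
  by_cases hij : i = j
  · subst hij
    exact h z hz
  · exact hD.orthogonal p i j hij v hv z hz

theorem le_perp (hD : IsOrthogonalSplitting g D) {i j : ι} (hji : j ≠ i) (p : M) :
    D j p ≤ perp g (D i) p :=
  fun w hw => mem_perp.2 fun v hv => hD.orthogonal p i j hji.symm v hv w hw

theorem isSection_perp (hD : IsOrthogonalSplitting g D) {i j : ι} (hji : j ≠ i)
    {X : ∀ p : M, Tan E p} (hX : IsSection (D j) X) : IsSection (perp g (D i)) X :=
  ⟨hX.1, fun p => hD.le_perp hji p (hX.2 p)⟩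

variable [FiniteDimensional ℝ E]

theorem linearMap_apply_eq_zero_of_mem_perp (hD : IsOrthogonalSplitting g D) {i : ι} {p : M}
    {F : Type*} [AddCommGroup F] [Module ℝ F] {α : Tan E p →ₗ[ℝ] F}
    (h : ∀ j, j ≠ i → ∀ z ∈ D j p, α z = 0) {z : Tan E p} (hz : z ∈ perp g (D i) p) :
    α z = 0 := by
  have hDi := hD.isNondegenerate i
  have α_comp : α ∘ₗ (LinearMap.id - proj g (D i) p) = 0 := by
    refine hD.linearMap_eq_zero fun j v hv => ?_
    rw [LinearMap.comp_apply, LinearMap.sub_apply, LinearMap.id_apply]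
    by_cases hji : j = i
    · subst hji
      rw [hDi.proj_of_mem hv, sub_self, map_zero]
    · rw [hDi.proj_eq_zero_iff.2 (hD.orthogonal p j i hji v hv), sub_zero, h j hji v hv]
  have proj_z : proj g (D i) p z = 0 :=
    hDi.proj_eq_zero_iff.2 fun v hv => (g.symm p z v).trans (mem_perp.1 hz v hv)
  simpa [proj_z] using LinearMap.congr_fun α_comp z

theorem val_eq_of_mem_perp (hD : IsOrthogonalSplitting g D) {i : ι} {p : M} {v w : Tan E p}
    (h : ∀ j, j ≠ i → ∀ z ∈ D j p, g.val p v z = g.val p w z) {z : Tan E p}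
    (hz : z ∈ perp g (D i) p) : g.val p v z = g.val p w z := by
  have val_sub := hD.linearMap_apply_eq_zero_of_mem_perp
    (α := (g.val p v - g.val p w).toLinearMap) (fun j hj z hz => sub_eq_zero.2 (h j hj z hz)) hz
  exact sub_eq_zero.1 val_sub

end IsOrthogonalSplitting

end Splitting

section Involutive

variable [IsManifold 𝓘(ℝ, E) ∞ M]

theorem mvfderiv_mlieBracket_eq_zero [CompleteSpace E] {F : Type*} [NormedAddCommGroup F]
    [NormedSpace ℝ F] {f : M → F} {X Y : ∀ p : M, Tan E p} {p : M}
    (hf : ContMDiffAt 𝓘(ℝ, E) 𝓘(ℝ, F) ∞ f p) (hX : SmoothFieldAt X p) (hY : SmoothFieldAt Y p)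
    (hfX : ∀ᶠ q in 𝓝 p, mvfderiv 𝓘(ℝ, E) f q (X q) = 0)
    (hfY : ∀ᶠ q in 𝓝 p, mvfderiv 𝓘(ℝ, E) f q (Y q) = 0) :
    mvfderiv 𝓘(ℝ, E) f p (VectorField.mlieBracket 𝓘(ℝ, E) X Y p) = 0 := by
  refine SeparatingDual.eq_zero_of_forall_dual_eq_zero (R := ℝ) fun L => ?_
  have diff_comp {q : M} (hq : MDifferentiableAt 𝓘(ℝ, E) 𝓘(ℝ, F) f q) (v : Tan E q) :
      diff E (L ∘ f) q v = L (mvfderiv 𝓘(ℝ, E) f q v) := by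
    rw [diff, mvfderiv_comp_apply q
      (L.contMDiff.contMDiffAt.mdifferentiableAt one_ne_zero) hq, mvfderiv, mfderiv_eq_fderiv,
      L.fderiv]
    rfl
  have diff_eq_zero {W : ∀ p : M, Tan E p}
      (hW : ∀ᶠ q in 𝓝 p, mvfderiv 𝓘(ℝ, E) f q (W q) = 0) :
      diff E (fun q => diff E (L ∘ f) q (W q)) p = 0 := by
    have eventually_zero : (fun q => diff E (L ∘ f) q (W q)) =ᶠ[𝓝 p] fun _ => 0 := by
      filter_upwards [hW, (contMDiffAt_iff_contMDiffAt_nhds (by simp)).1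
        (hf.of_le (m := 1) (by simp))] with q hq hfq
      rw [diff_comp (hfq.mdifferentiableAt one_ne_zero), hq, map_zero]
    rw [diff_congr eventually_zero, diff, mvfderiv_const]
  have hLf : ContMDiffAt 𝓘(ℝ, E) 𝓘(ℝ, ℝ) ∞ (L ∘ f) p := L.contMDiff.contMDiffAt.comp p hf
  rw [← diff_comp (hf.mdifferentiableAt (by simp)), diff_mlieBracket hLf hX hY,
    diff_eq_zero hfX, diff_eq_zero hfY, zero_apply, zero_apply, sub_zero]

variable {ι : Type*}

/-- Brackets of sections of `D i` and `D j` are sections of `D i + D j`. For `i = j` this is the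
involutivity of `D i`. -/
def IsPairwiseInvolutive (D : ι → Dist E M) : Prop :=
  ∀ i j X Y, IsSection (D i) X → IsSection (D j) Y →
    ∀ p, VectorField.mlieBracket 𝓘(ℝ, E) X Y p ∈ D i p ⊔ D j p

theorem IsLocallyProduct.isPairwiseInvolutive [CompleteSpace E] [Fintype ι] {D : ι → Dist E M}
    (hD : IsLocallyProduct D) (iSup_eq_top : ∀ p, ⨆ i, D i p = ⊤) : IsPairwiseInvolutive D := by
  classical
  intro i j X Y hX hY p
  obtain ⟨d, φ, U, hp, -, -, hφ, -, mem_iff⟩ := hD p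
  have near_p : ∀ᶠ q in 𝓝 p, q ∈ φ.source := φ.open_source.mem_nhds hp
  set w := VectorField.mlieBracket 𝓘(ℝ, E) X Y p
  have deriv_bracket (l : ι) (hli : l ≠ i) (hlj : l ≠ j) :
      mvfderiv 𝓘(ℝ, E) (fun x => φ x l) p w = 0 := by
    have hφl : ContMDiffAt 𝓘(ℝ, E) 𝓘(ℝ, EuclideanSpace ℝ (Fin (d l))) ∞ (fun x => φ x l) p :=
      (ContinuousLinearMap.proj (R := ℝ) (φ := fun i => EuclideanSpace ℝ (Fin (d i)))
        l).contMDiff.contMDiffAt.comp p (hφ.contMDiffAt near_p)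
    exact mvfderiv_mlieBracket_eq_zero hφl (hX.1 p) (hY.1 p)
      (near_p.mono fun q hq => (mem_iff q hq i _).1 (hX.2 q) l hli)
      (near_p.mono fun q hq => (mem_iff q hq j _).1 (hY.2 q) l hlj)
  obtain ⟨c, hc, sum_c⟩ : ∃ c : ι → Tan E p, (∀ l, c l ∈ D l p) ∧ ∑ l, c l = w := by
    have mem_iSup : w ∈ ⨆ l ∈ Finset.univ, D l p := by
      simp only [Finset.mem_univ, iSup_pos, iSup_eq_top p, Submodule.mem_top]
    obtain ⟨c, hc⟩ := (Submodule.mem_iSup_finset_iff_exists_sum _ _).1 mem_iSup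
    exact ⟨fun l => c l, fun l => (c l).2, hc⟩
  have deriv_component (l : ι) :
      mvfderiv 𝓘(ℝ, E) (fun x => φ x l) p (c l) = mvfderiv 𝓘(ℝ, E) (fun x => φ x l) p w := by
    rw [← sum_c, map_sum, Finset.sum_eq_single l _ (by simp)]
    exact fun k _ hkl => (mem_iff p hp k _).1 (hc k) l hkl.symm
  rw [← sum_c]
  refine Submodule.sum_mem _ fun l _ => ?_
  by_cases hlj : l = j
  · exact Submodule.mem_sup_right (hlj ▸ hc l)
  by_cases hli : l = i
  · exact Submodule.mem_sup_left (hli ▸ hc l)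
  refine Submodule.mem_sup_left ((mem_iff p hp i _).2 fun k _ => ?_)
  by_cases hkl : k = l
  · rw [hkl, deriv_component, deriv_bracket l hli hlj]
  · exact (mem_iff p hp l _).1 (hc l) k hkl

theorem IsPairwiseInvolutive.val_mlieBracket_eq_zero {g : Metric E M} {D : ι → Dist E M}
    (hD : IsPairwiseInvolutive D) (hs : IsOrthogonalSplitting g D) {i j k : ι} (hik : i ≠ k)
    (hjk : j ≠ k) {X Y : ∀ p : M, Tan E p} (hX : IsSection (D i) X) (hY : IsSection (D j) Y)
    {p : M} {z : Tan E p} (hz : z ∈ D k p) :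
    g.val p (VectorField.mlieBracket 𝓘(ℝ, E) X Y p) z = 0 := by
  have mem := (sup_le (hs.le_perp hik p) (hs.le_perp hjk p)) (hD i j X Y hX hY p)
  exact (g.symm p _ z).trans (mem_perp.1 mem z hz)

end Involutive

section UmbilicalNet

variable [IsManifold 𝓘(ℝ, E) ∞ M] [FiniteDimensional ℝ E] {g : Metric E M} {ι : Type*}
  {D : ι → Dist E M} {u : ι → ι → M → ℝ}

theorem IsOrthogonalSplitting.val_nabla_eq_zero (hs : IsOrthogonalSplitting g D)
    (hD : IsPairwiseInvolutive D) {i j k : ι} (hij : i ≠ j) (hjk : j ≠ k) (hik : i ≠ k)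
    {X Y Z : ∀ p : M, Tan E p} (hX : IsSection (D i) X) (hY : IsSection (D j) Y)
    (hZ : IsSection (D k) Z) (p : M) : g.val p (nabla g X Y p) (Z p) = 0 := by
  rw [nabla_koszul (hX.diffFieldAt p) (hY.diffFieldAt p) (hZ.diffFieldAt p), koszul,
    diff_val_eq_zero fun q => hs.orthogonal q j k hjk _ (hY.2 q) _ (hZ.2 q),
    diff_val_eq_zero fun q => hs.orthogonal q k i hik.symm _ (hZ.2 q) _ (hX.2 q),
    diff_val_eq_zero fun q => hs.orthogonal q i j hij _ (hX.2 q) _ (hY.2 q),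
    hD.val_mlieBracket_eq_zero hs hik hjk hX hY (hZ.2 p),
    hD.val_mlieBracket_eq_zero hs hij.symm hik.symm hY hZ (hX.2 p),
    hD.val_mlieBracket_eq_zero hs hjk.symm hij hZ hX (hY.2 p)]
  simp

/-- An orthogonal net of umbilical distributions whose mean curvature normals derive from
potentials: the component along `D j` of the mean curvature normal of `D i` is the projection of the
gradient of a function `u i j`, and `u i j = u j i`. The diagonal functions `u i i` are
irrelevant. -/
structure IsUmbilicalNet (g : Metric E M) (D : ι → Dist E M) (u : ι → ι → M → ℝ) : Prop
    extends IsOrthogonalSplitting g D where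
  ne_bot : ∀ i p, D i p ≠ ⊥
  smooth : ∀ i, IsSmoothDist g (D i)
  involutive : IsPairwiseInvolutive D
  smooth_potential : ∀ i j, i ≠ j → SmoothFun E (u i j)
  potential_symm : ∀ i j, u i j = u j i
  val_nabla : ∀ i j, j ≠ i → ∀ X Y, IsSection (D i) X → IsSection (D i) Y →
    ∀ p, ∀ z ∈ D j p, g.val p (nabla g X Y p) z = g.val p (X p) (Y p) * diff E (u i j) p z

namespace IsUmbilicalNet

section Geodesic

theorem val_nabla_eq_zero (h : IsUmbilicalNet g D u) {i : ι}
    (hu : ∀ j, j ≠ i → IndependentOf (u j i) (D i)) {j k : ι} (hj : j ≠ i) (hk : k ≠ i)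
    {X Y Z : ∀ p : M, Tan E p} (hX : IsSection (D j) X) (hY : IsSection (D k) Y)
    (hZ : IsSection (D i) Z) (p : M) : g.val p (nabla g X Y p) (Z p) = 0 := by
  by_cases hjk : j = k
  · subst hjk
    rw [h.val_nabla j i hj.symm X Y hX hY p _ (hZ.2 p), hu j hj p _ (hZ.2 p), mul_zero]
  · exact h.toIsOrthogonalSplitting.val_nabla_eq_zero h.involutive hjk hk hj hX hY hZ p

variable [T2Space M]

theorem exists_isSection (h : IsUmbilicalNet g D u) (i : ι) {p : M} {v : Tan E p}
    (hv : v ∈ D i p) : ∃ X, IsSection (D i) X ∧ X p = v :=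
  (h.smooth i).exists_isSection (h.isNondegenerate i) hv

theorem exists_isSection_val_ne_zero (h : IsUmbilicalNet g D u) (i : ι) (p : M) :
    ∃ X Y, IsSection (D i) X ∧ IsSection (D i) Y ∧ g.val p (X p) (Y p) ≠ 0 := by
  obtain ⟨v, hv, hv0⟩ := Submodule.exists_mem_ne_zero_of_ne_bot (h.ne_bot i p)
  obtain ⟨w, hw, hvw⟩ := (h.isNondegenerate i).exists_val_ne_zero hv hv0
  obtain ⟨X, hX, rfl⟩ := h.exists_isSection i hv
  obtain ⟨Y, hY, rfl⟩ := h.exists_isSection i hw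
  exact ⟨X, Y, hX, hY, hvw⟩

theorem isGeodesic_iff (h : IsUmbilicalNet g D u) (i : ι) :
    IsGeodesic g (D i) ↔ ∀ j, j ≠ i → IndependentOf (u i j) (D j) := by
  have hD := h.isNondegenerate i
  constructor
  · intro geodesic j hj p z hz
    obtain ⟨X, Y, hX, hY, hXY⟩ := h.exists_isSection_val_ne_zero i p
    have val_zero := hD.secondForm_eq_zero_iff.1 (geodesic.secondForm_eq X Y hX hY p) z
      (h.le_perp hj p hz)
    rw [h.val_nabla i j hj X Y hX hY p z hz] at val_zero
    exact (mul_eq_zero.1 val_zero).resolve_left hXY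
  · refine fun hu => ⟨hD, fun X Y hX hY p => hD.secondForm_eq_zero_iff.2 fun z hz => ?_⟩
    refine h.linearMap_apply_eq_zero_of_mem_perp (α := (g.val p (nabla g X Y p)).toLinearMap)
      (fun j hj w hw => ?_) hz
    change g.val p (nabla g X Y p) w = 0
    rw [h.val_nabla i j hj X Y hX hY p w hw, hu j hj p w hw, mul_zero]

theorem val_nabla_perp_eq_zero (h : IsUmbilicalNet g D u) {i : ι}
    (hu : ∀ j, j ≠ i → IndependentOf (u j i) (D i)) {X Z : ∀ p : M, Tan E p}
    (hX : IsSection (perp g (D i)) X) (hZ : IsSection (D i) Z) {p : M} {w : Tan E p}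
    (hw : w ∈ perp g (D i) p) : g.val p w (nabla g X Z p) = 0 := by
  have tensorial := tensorialAt_nabla (g := g) (hZ.diffFieldAt p)
  let nablaZ := (TensorialAt.mkHom (fun W => nabla g W Z p) p tensorial).toLinearMap
  have nablaZ_apply {W : ∀ p : M, Tan E p} (hW : DiffFieldAt W p) :
      nablaZ (W p) = nabla g W Z p := TensorialAt.mkHom_apply tensorial hW
  have val_nablaZ (j : ι) (hj : j ≠ i) (v : Tan E p) (hv : v ∈ D j p) :
      g.val p w (nablaZ v) = 0 := by
    obtain ⟨V, hV, rfl⟩ := h.exists_isSection j hv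
    rw [nablaZ_apply (hV.diffFieldAt p), g.symm]
    refine h.linearMap_apply_eq_zero_of_mem_perp (α := (g.val p (nabla g V Z p)).toLinearMap)
      (fun k hk y hy => ?_) hw
    obtain ⟨Y, hY, rfl⟩ := h.exists_isSection k hy
    have val_nabla_Y := h.val_nabla_eq_zero hu hj hk hV hY hZ p
    rw [val_nabla_of_orthogonal (hV.diffFieldAt p) (hY.diffFieldAt p) (hZ.diffFieldAt p)
      fun q => h.orthogonal q k i hk _ (hY.2 q) _ (hZ.2 q), neg_eq_zero, g.symm] at val_nabla_Y
    exact val_nabla_Y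
  rw [← nablaZ_apply (hX.diffFieldAt p)]
  exact h.linearMap_apply_eq_zero_of_mem_perp (α := (g.val p w).toLinearMap ∘ₗ nablaZ)
    val_nablaZ (hX.2 p)

theorem isGeodesic_perp_iff (h : IsUmbilicalNet g D u) (i : ι) :
    IsGeodesic g (perp g (D i)) ↔ ∀ j, j ≠ i → IndependentOf (u j i) (D i) := by
  have hD := h.isNondegenerate i
  constructor
  · intro geodesic j hj p z hz
    obtain ⟨X, Y, hX, hY, hXY⟩ := h.exists_isSection_val_ne_zero j p
    have val_zero := hD.perp.secondForm_eq_zero_iff.1 (geodesic.secondForm_eq X Y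
      (h.isSection_perp hj hX) (h.isSection_perp hj hY) p) z (by rwa [perp_perp])
    rw [h.val_nabla j i hj.symm X Y hX hY p z hz] at val_zero
    exact (mul_eq_zero.1 val_zero).resolve_left hXY
  · refine fun hu => ⟨hD.perp, fun X Y hX hY p => hD.perp.secondForm_eq_zero_iff.2 fun z hz => ?_⟩
    rw [perp_perp] at hz
    obtain ⟨Z, hZ, rfl⟩ := h.exists_isSection i hz
    have orthogonal (q : M) : g.val q (Y q) (Z q) = 0 :=
      (g.symm q _ _).trans (mem_perp.1 (hY.2 q) _ (hZ.2 q))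
    rw [val_nabla_of_orthogonal (hX.diffFieldAt p) (hY.diffFieldAt p) (hZ.diffFieldAt p)
      orthogonal, h.val_nabla_perp_eq_zero hu hX hZ (hY.2 p), neg_zero]

end Geodesic

section MeanNormal

variable [Fintype ι]

open Classical in
variable (g D u) in
/-- The mean curvature normal of the distribution `D i` of an umbilical net with potentials `u`. -/
def meanNormal (i : ι) (p : M) : Tan E p :=
  ∑ j ∈ Finset.univ.erase i, proj g (D j) p (g.grad (u i j) p)

theorem val_meanNormal (h : IsUmbilicalNet g D u) {i j : ι} (hj : j ≠ i) {p : M} {z : Tan E p}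
    (hz : z ∈ D j p) : g.val p (meanNormal g D u i p) z = diff E (u i j) p z := by
  classical
  rw [meanNormal, map_sum, sum_apply, Finset.sum_eq_single j]
  · rw [(h.isNondegenerate j).val_proj _ hz, g.val_grad]
  · exact fun k _ hkj => h.orthogonal p k j hkj _ ((h.isNondegenerate k).proj_mem p _) z hz
  · exact fun hj' => absurd (Finset.mem_erase.2 ⟨hj, Finset.mem_univ j⟩) hj'

theorem isSection_meanNormal (h : IsUmbilicalNet g D u) (i : ι) :
    IsSection (perp g (D i)) (meanNormal g D u i) := by
  classical
  refine ⟨ContMDiff.sum_section fun j hj => ?_, fun p => Submodule.sum_mem _ fun j hj => ?_⟩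
  · exact h.smooth j _
      (g.smoothField_grad (h.smooth_potential i j (Finset.ne_of_mem_erase hj).symm))
  · exact h.le_perp (Finset.ne_of_mem_erase hj) p ((h.isNondegenerate j).proj_mem p _)

theorem secondForm_eq (h : IsUmbilicalNet g D u) {i : ι} {X Y : ∀ p : M, Tan E p}
    (hX : IsSection (D i) X) (hY : IsSection (D i) Y) (p : M) :
    secondForm g (D i) X Y p = g.val p (X p) (Y p) • meanNormal g D u i p := by
  refine ((h.isNondegenerate i).perp.proj_eq_iff
    (Submodule.smul_mem _ _ ((h.isSection_meanNormal i).2 p))).2 fun z hz => ?_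
  refine h.val_eq_of_mem_perp (fun j hj y hy => ?_) hz
  rw [h.val_nabla i j hj X Y hX hY p y hy, map_smul, smul_apply, h.val_meanNormal hj hy,
    smul_eq_mul]

theorem isUmbilicalWith_meanNormal (h : IsUmbilicalNet g D u) (i : ι) :
    IsUmbilicalWith g (D i) (meanNormal g D u i) := by
  refine ⟨h.isNondegenerate i, ⟨h.isSection_meanNormal i, fun p X hX _ hne => ?_⟩,
    fun X Y hX hY p => h.secondForm_eq hX hY p⟩
  have trace_term (a : Fin (Module.finrank ℝ (D i p))) :
      (g.val p (X a p) (X a p))⁻¹ • symSecondForm g (D i) (X a) (X a) p =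
        meanNormal g D u i p := by
    rw [symSecondForm_self, h.secondForm_eq (hX a) (hX a), inv_smul_smul₀ (hne a)]
  rw [Finset.sum_congr rfl fun a _ => trace_term a, Finset.sum_const, Finset.card_univ,
    Fintype.card_fin, Nat.cast_smul_eq_nsmul]

theorem val_meanNormal_mlieBracket (h : IsUmbilicalNet g D u) {i j : ι} (hj : j ≠ i)
    (hu : IndependentOf (u i j) (D i)) {X Z : ∀ p : M, Tan E p}
    (hX : IsSection (D i) X) (hZ : IsSection (D j) Z) (p : M) :
    g.val p (meanNormal g D u i p) (VectorField.mlieBracket 𝓘(ℝ, E) X Z p) =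
      diff E (u i j) p (VectorField.mlieBracket 𝓘(ℝ, E) X Z p) := by
  obtain ⟨x, hx, z, hz, hxz⟩ := Submodule.mem_sup.1 (h.involutive i j X Z hX hZ p)
  have val_x : g.val p (meanNormal g D u i p) x = 0 :=
    (g.symm p _ x).trans (mem_perp.1 ((h.isSection_meanNormal i).2 p) x hx)
  rw [← hxz, map_add, map_add, val_x, hu p x hx, h.val_meanNormal hj hz]

end MeanNormal

section Killing

variable [T2Space M]

theorem isSpherical [Finite ι] (h : IsUmbilicalNet g D u) {i : ι}
    (hu : ∀ j, j ≠ i → IndependentOf (u i j) (D i)) : IsSpherical g (D i) := by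
  obtain ⟨_⟩ := nonempty_fintype ι
  refine ⟨meanNormal g D u i, h.isUmbilicalWith_meanNormal i, fun X hX p => ?_⟩
  have hH := h.isSection_meanNormal i
  refine (h.isNondegenerate i).perp.proj_eq_zero_iff.2 fun z hz => ?_
  refine h.linearMap_apply_eq_zero_of_mem_perp
    (α := (g.val p (nabla g X (meanNormal g D u i) p)).toLinearMap) (fun j hj z hz => ?_) hz
  obtain ⟨Z, hZ, rfl⟩ := h.exists_isSection j hz
  exact val_nabla_eq_zero_of_val_eq_diff (h.smooth_potential i j hj.symm) (hX.1 p)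
    (hH.diffFieldAt p) (hZ.1 p) (fun q => h.val_meanNormal hj (hZ.2 q))
    (fun q => hu j hj q _ (hX.2 q)) (h.val_meanNormal_mlieBracket hj (hu j hj) hX hZ p)
    (h.val_nabla_perp_eq_zero (fun k hk => h.potential_symm i k ▸ hu k hk)
      (h.isSection_perp hj hZ) hX (hH.2 p))

theorem isKilling_iff [Finite ι] (h : IsUmbilicalNet g D u) (i : ι) :
    IsKilling g (D i) ↔ ∀ j, j ≠ i → IndependentOf (u i j) (D i) := by
  have perp_iff := h.isGeodesic_perp_iff i
  simp only [h.potential_symm _ i] at perp_iff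
  exact ⟨fun killing => perp_iff.1 killing.2, fun hu => ⟨h.isSpherical hu, perp_iff.2 hu⟩⟩

end Killing

end IsUmbilicalNet

end UmbilicalNet

section EigenPotential

variable {ι : Type*}

/-- The function `-½ log |λᵢ - λⱼ|`, from which the mean curvature normals of the eigenspaces of a
conformal Killing tensor derive. The absolute value is built into `Real.log`. -/
def eigenPotential {S : Type*} (lam : ι → S → ℝ) (i j : ι) (p : S) : ℝ :=
  -(1 / 2) * Real.log (lam i p - lam j p)

theorem eigenPotential_symm {S : Type*} (lam : ι → S → ℝ) (i j : ι) :
    eigenPotential lam i j = eigenPotential lam j i := by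
  funext p
  rw [eigenPotential, eigenPotential, ← Real.log_neg_eq_log, neg_sub]

variable {lam : ι → M → ℝ} {i j : ι}

theorem smoothFun_eigenPotential (hi : SmoothFun E (lam i)) (hj : SmoothFun E (lam j))
    (hne : ∀ p, lam i p ≠ lam j p) : SmoothFun E (eigenPotential lam i j) := by
  intro p
  have log_smooth : ContDiffAt ℝ ∞ Real.log (lam i p - lam j p) :=
    Real.contDiffAt_log.2 (sub_ne_zero.2 (hne p))
  exact contMDiffAt_const.mul (log_smooth.contMDiffAt.comp p ((hi p).sub (hj p)))

theorem diff_eigenPotential (hi : SmoothFun E (lam i)) (hj : SmoothFun E (lam j)) {p : M}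
    (hne : lam i p ≠ lam j p) (v : Tan E p) :
    diff E (eigenPotential lam i j) p v =
      (2 * (lam i p - lam j p))⁻¹ * (diff E (lam j) p v - diff E (lam i) p v) := by
  have h0 := sub_ne_zero.2 hne
  have di := hi.mdifferentiable (by simp) p
  have dj := hj.mdifferentiable (by simp) p
  let F : ℝ → ℝ := fun s => -(1 / 2) * Real.log s
  have hF : HasDerivAt F (-(1 / 2) * (lam i p - lam j p)⁻¹) ((lam i - lam j) p) :=
    (Real.hasDerivAt_log h0).const_mul _
  have comp_eq : eigenPotential lam i j = F ∘ (lam i - lam j) := rfl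
  have diff_sub := DFunLike.congr_fun (mvfderiv_sub di dj) v
  rw [comp_eq, diff, mvfderiv_comp_apply p hF.differentiableAt.mdifferentiableAt (di.sub dj),
    mvfderiv, mfderiv_eq_fderiv, hF.hasFDerivAt.fderiv]
  change diff E (lam i - lam j) p v = diff E (lam i) p v - diff E (lam j) p v at diff_sub
  change diff E (lam i - lam j) p v * (-(1 / 2) * (lam i p - lam j p)⁻¹) = _
  rw [diff_sub, mul_inv]
  ring

end EigenPotential

section Eigenspaces

variable [IsManifold 𝓘(ℝ, E) ∞ M] [FiniteDimensional ℝ E] {g : Metric E M} {T : SymTensor E M}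

theorem mem_eigenDist {μ : M → ℝ} {p : M} {v : Tan E p} :
    v ∈ eigenDist g T μ p ↔ T.endo g p v = μ p • v :=
  Module.End.mem_eigenspace_iff

theorem val_nablaEndo_of_isSection {μ ν : M → ℝ} {X Y : ∀ p : M, Tan E p} {p : M}
    (hμ : SmoothFun E μ) (hX : DiffFieldAt X p) (hY : IsSection (eigenDist g T μ) Y)
    {z : Tan E p} (hz : z ∈ eigenDist g T ν p) :
    g.val p (nablaEndo g T X Y p) z =
      diff E μ p (X p) * g.val p (Y p) z + (μ p - ν p) * g.val p (nabla g X Y p) z := by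
  rw [nablaEndo_eigenfield (hμ.mdifferentiable (by simp) p) hX (hY.diffFieldAt p)
    fun q => mem_eigenDist.1 (hY.2 q)]
  simp only [map_add, map_sub, map_smul, add_apply, sub_apply, smul_apply, smul_eq_mul,
    T.val_endo_comm, mem_eigenDist.1 hz]
  ring

variable {ι : Type*} {lam : ι → M → ℝ}

theorem IsOrthogonalTensor.isOrthogonalSplitting (hO : IsOrthogonalTensor g T lam) :
    IsOrthogonalSplitting g fun i => eigenDist g T (lam i) where
  orthogonal p i j hij v hv w hw := by
    have comm := T.val_endo_comm g p v w
    rw [mem_eigenDist.1 hv, mem_eigenDist.1 hw, map_smul, map_smul, smul_apply, smul_eq_mul,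
      smul_eq_mul, ← sub_eq_zero, ← sub_mul] at comm
    exact (mul_eq_zero.1 comm).resolve_left (sub_ne_zero.2 (hO.distinct p i j hij))
  iSup_eq_top := hO.diagonalizable

theorem IsNondegenerate.proj_endo {μ : M → ℝ} (hD : IsNondegenerate g (eigenDist g T μ))
    (p : M) (v : Tan E p) :
    proj g (eigenDist g T μ) p (T.endo g p v) = μ p • proj g (eigenDist g T μ) p v := by
  refine (hD.proj_eq_iff (Submodule.smul_mem _ _ (hD.proj_mem p v))).2 fun z hz => ?_
  rw [T.val_endo_comm, mem_eigenDist.1 hz, map_smul, map_smul, smul_apply, hD.val_proj v hz]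

theorem IsOrthogonalTensor.exists_smoothField_proj_eq (hO : IsOrthogonalTensor g T lam)
    {X : ∀ p : M, Tan E p} (hX : SmoothField X) (s : Finset ι) :
    ∃ Y : ∀ p : M, Tan E p, SmoothField Y ∧ ∀ j p,
      proj g (eigenDist g T (lam j)) p (Y p) =
        (∏ k ∈ s, (lam j p - lam k p)) • proj g (eigenDist g T (lam j)) p (X p) := by
  classical
  induction s using Finset.induction_on with
  | empty => exact ⟨X, hX, fun j p => by rw [Finset.prod_empty, one_smul]⟩
  | insert k s hk ih =>
    obtain ⟨Y, hY, hYX⟩ := ih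
    have hTY : SmoothField fun p => T.endo g p (Y p) := fun p => T.smoothFieldAt_endo g (hY p)
    refine ⟨(fun p => T.endo g p (Y p)) - lam k • Y,
      hTY.sub_section ((hO.smooth k).smul_section hY), fun j p => ?_⟩
    rw [Pi.sub_apply, Pi.smul_apply', map_sub, map_smul,
      (hO.isOrthogonalSplitting.isNondegenerate j).proj_endo, ← sub_smul, hYX, smul_smul,
      Finset.prod_insert hk]

theorem IsOrthogonalTensor.isSmoothDist_eigenDist [Finite ι] (hO : IsOrthogonalTensor g T lam)
    (i : ι) : IsSmoothDist g (eigenDist g T (lam i)) := by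
  classical
  obtain ⟨_⟩ := nonempty_fintype ι
  intro X hX
  have hs := hO.isOrthogonalSplitting
  have hD := hs.isNondegenerate
  -- Up to a nowhere vanishing factor, the projection is the product of the `T - λₖ` with `k ≠ i`.
  obtain ⟨Y, hY, hYX⟩ := hO.exists_smoothField_proj_eq hX (Finset.univ.erase i)
  let c (p : M) : ℝ := ∏ k ∈ Finset.univ.erase i, (lam i p - lam k p)
  have c_ne_zero (p : M) : c p ≠ 0 := Finset.prod_ne_zero_iff.2 fun k hk =>
    sub_ne_zero.2 (hO.distinct p i k (Finset.ne_of_mem_erase hk).symm)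
  have c_smooth : SmoothFun E c :=
    contMDiff_finsetProd fun k _ => (hO.smooth i).sub (hO.smooth k)
  have Y_eq (p : M) : Y p = c p • proj g (eigenDist g T (lam i)) p (X p) := by
    refine hs.eq_of_forall_val_eq fun j z hz => ?_
    rw [← (hD j).val_proj (Y p) hz, hYX]
    by_cases hji : j = i
    · rw [hji]
    · rw [Finset.prod_eq_zero (Finset.mem_erase.2 ⟨hji, Finset.mem_univ j⟩) (sub_self _),
        zero_smul, map_zero, zero_apply, map_smul, smul_apply,
        hs.orthogonal p i j (Ne.symm hji) _ ((hD i).proj_mem p _) z hz, smul_zero]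
  have proj_eq : (fun p => proj g (eigenDist g T (lam i)) p (X p)) = (fun p => (c p)⁻¹) • Y :=
    funext fun p => by rw [Pi.smul_apply', Y_eq, inv_smul_smul₀ (c_ne_zero p)]
  rw [proj_eq]
  exact (c_smooth.inv₀ c_ne_zero).smul_section hY

end Eigenspaces

section ConformalKilling

variable [IsManifold 𝓘(ℝ, E) ∞ M] [FiniteDimensional ℝ E] [T2Space M] {g : Metric E M}
  {T : SymTensor E M} {ι : Type*} [Finite ι] {lam : ι → M → ℝ} {t : ∀ p : M, Tan E p}

theorem diff_eq_val_of_mem_eigenDist (hO : IsOrthogonalTensor g T lam)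
    (hT : IsConformalKilling g T t) (i : ι) {p : M} {v : Tan E p}
    (hv : v ∈ eigenDist g T (lam i) p) : diff E (lam i) p v = g.val p (t p) v := by
  have hD := hO.isOrthogonalSplitting.isNondegenerate i
  have hs := hO.isSmoothDist_eigenDist i
  refine sub_eq_zero.1 (hD.linearMap_apply_eq_zero_of_cyclic
    (α := (diff E (lam i) p - g.val p (t p)).toLinearMap) (fun x hx y hy z hz => ?_) hv)
  obtain ⟨X, hX, rfl⟩ := hs.exists_isSection hD hx
  obtain ⟨Y, hY, rfl⟩ := hs.exists_isSection hD hy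
  obtain ⟨Z, hZ, rfl⟩ := hs.exists_isSection hD hz
  have cyclic := hT.cyclic_val_nablaEndo (hX.diffFieldAt p) (hY.diffFieldAt p) (hZ.diffFieldAt p)
  rw [val_nablaEndo_of_isSection (hO.smooth i) (hX.diffFieldAt p) hY (hZ.2 p),
    val_nablaEndo_of_isSection (hO.smooth i) (hY.diffFieldAt p) hZ (hX.2 p),
    val_nablaEndo_of_isSection (hO.smooth i) (hZ.diffFieldAt p) hX (hY.2 p)] at cyclic
  simp only [ContinuousLinearMap.coe_coe, sub_apply]
  linarith

theorem val_nabla_of_mem_eigenDist (hO : IsOrthogonalTensor g T lam)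
    (hI : IsPairwiseInvolutive fun i => eigenDist g T (lam i)) (hT : IsConformalKilling g T t)
    {i j : ι} (hji : j ≠ i) {X Y : ∀ p : M, Tan E p} (hX : IsSection (eigenDist g T (lam i)) X)
    (hY : IsSection (eigenDist g T (lam i)) Y) {p : M} {z : Tan E p}
    (hz : z ∈ eigenDist g T (lam j) p) :
    2 * (lam i p - lam j p) * g.val p (nabla g X Y p) z =
      g.val p (X p) (Y p) * (diff E (lam j) p z - diff E (lam i) p z) := by
  have hs := hO.isOrthogonalSplitting
  have t_eq := diff_eq_val_of_mem_eigenDist hO hT j hz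
  obtain ⟨Z, hZ, rfl⟩ := (hO.isSmoothDist_eigenDist j).exists_isSection (hs.isNondegenerate j) hz
  have dX := hX.diffFieldAt p
  have dY := hY.diffFieldAt p
  have dZ := hZ.diffFieldAt p
  have YZ_orthogonal : g.val p (Y p) (Z p) = 0 := hs.orthogonal p i j hji.symm _ (hY.2 p) _ (hZ.2 p)
  have ZX_orthogonal (q : M) : g.val q (Z q) (X q) = 0 :=
    hs.orthogonal q j i hji _ (hZ.2 q) _ (hX.2 q)
  have nabla_comm : g.val p (nabla g Y X p) (Z p) = g.val p (nabla g X Y p) (Z p) := by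
    rw [nabla_eq_nabla_add_mlieBracket dX dY, map_add, add_apply,
      hI.val_mlieBracket_eq_zero hs hji.symm hji.symm hX hY (hZ.2 p), add_zero]
  have nabla_YZ : g.val p (nabla g Y Z p) (X p) = -g.val p (nabla g X Y p) (Z p) := by
    rw [val_nabla_of_orthogonal dY dZ dX ZX_orthogonal, g.symm, nabla_comm]
  have cyclic := hT.cyclic_val_nablaEndo dX dY dZ
  rw [val_nablaEndo_of_isSection (hO.smooth i) dX hY (hZ.2 p),
    val_nablaEndo_of_isSection (hO.smooth j) dY hZ (hX.2 p),
    val_nablaEndo_of_isSection (hO.smooth i) dZ hX (hY.2 p), YZ_orthogonal, ZX_orthogonal p,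
    nabla_YZ, ← t_eq] at cyclic
  linarith

theorem isUmbilicalNet_eigenDist (hO : IsOrthogonalTensor g T lam)
    (hI : IsPairwiseInvolutive fun i => eigenDist g T (lam i)) (hT : IsConformalKilling g T t) :
    IsUmbilicalNet g (fun i => eigenDist g T (lam i)) (eigenPotential lam) where
  toIsOrthogonalSplitting := hO.isOrthogonalSplitting
  ne_bot i p := hO.eigenvalue p i
  smooth := hO.isSmoothDist_eigenDist
  involutive := hI
  smooth_potential i j hij :=
    smoothFun_eigenPotential (hO.smooth i) (hO.smooth j) fun p => hO.distinct p i j hij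
  potential_symm := eigenPotential_symm lam
  val_nabla i j hji X Y hX hY p z hz := by
    have hne := hO.distinct p i j hji.symm
    have h0 := sub_ne_zero.2 hne
    have val_nabla := val_nabla_of_mem_eigenDist hO hI hT hji hX hY hz
    rw [diff_eigenPotential (hO.smooth i) (hO.smooth j) hne, mul_left_comm, ← val_nabla,
      inv_mul_cancel_left₀ (mul_ne_zero two_ne_zero h0)]

theorem independentOf_eigenPotential_iff (hO : IsOrthogonalTensor g T lam)
    (hT : IsConformalKilling g T t) {i j : ι} (hji : j ≠ i) :
    IndependentOf (eigenPotential lam i j) (eigenDist g T (lam i)) ↔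
      ∀ p, ∀ z ∈ eigenDist g T (lam i) p, diff E (lam j) p z = g.val p (t p) z := by
  refine forall₃_congr fun p z hz => ?_
  have hne := hO.distinct p i j hji.symm
  rw [diff_eigenPotential (hO.smooth i) (hO.smooth j) hne, diff_eq_val_of_mem_eigenDist hO hT i hz,
    mul_eq_zero_iff_left (inv_ne_zero (mul_ne_zero two_ne_zero (sub_ne_zero.2 hne))), sub_eq_zero]

theorem isKilling_eigenDist_iff (hO : IsOrthogonalTensor g T lam)
    (hI : IsPairwiseInvolutive fun i => eigenDist g T (lam i)) (hT : IsConformalKilling g T t)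
    (i : ι) :
    IsKilling g (eigenDist g T (lam i)) ↔
      ∀ j, j ≠ i → ∀ p, ∀ z ∈ eigenDist g T (lam i) p, diff E (lam j) p z = g.val p (t p) z :=
  ((isUmbilicalNet_eigenDist hO hI hT).isKilling_iff i).trans
    (forall₂_congr fun _ hji => independentOf_eigenPotential_iff hO hT hji)

theorem isGeodesic_eigenDist_iff (hO : IsOrthogonalTensor g T lam)
    (hI : IsPairwiseInvolutive fun i => eigenDist g T (lam i)) (hT : IsConformalKilling g T t)
    (i : ι) :
    IsGeodesic g (eigenDist g T (lam i)) ↔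
      ∀ j, j ≠ i → ∀ p, ∀ z ∈ eigenDist g T (lam j) p, diff E (lam i) p z = g.val p (t p) z := by
  refine ((isUmbilicalNet_eigenDist hO hI hT).isGeodesic_iff i).trans
    (forall₂_congr fun j hji => ?_)
  rw [eigenPotential_symm]
  exact independentOf_eigenPotential_iff hO hT hji.symm

theorem isKilling_eigenDist_iff_independentOf (hO : IsOrthogonalTensor g T lam)
    (hI : IsPairwiseInvolutive fun i => eigenDist g T (lam i)) (hT : IsKillingTensor g T)
    (i : ι) :
    IsKilling g (eigenDist g T (lam i)) ↔ ∀ j, IndependentOf (lam j) (eigenDist g T (lam i)) := by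
  rw [isKilling_eigenDist_iff hO hI hT]
  simp only [Pi.zero_apply, map_zero, zero_apply]
  refine ⟨fun h j => ?_, fun h j _ => h j⟩
  by_cases hji : j = i
  · subst hji
    exact fun p z hz => by simpa using diff_eq_val_of_mem_eigenDist hO hT j hz
  · exact h j hji

theorem isGeodesic_eigenDist_iff_isLocallyConstant (hO : IsOrthogonalTensor g T lam)
    (hI : IsPairwiseInvolutive fun i => eigenDist g T (lam i)) (hT : IsKillingTensor g T)
    (i : ι) : IsGeodesic g (eigenDist g T (lam i)) ↔ IsLocallyConstant (lam i) := by
  rw [isGeodesic_eigenDist_iff hO hI hT]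
  simp only [Pi.zero_apply, map_zero, zero_apply]
  refine ⟨fun h => isLocallyConstant_of_diff_eq_zero (hO.smooth i) fun p => ?_,
    fun h j _ p z _ => ?_⟩
  · refine ContinuousLinearMap.coe_injective
      (hO.isOrthogonalSplitting.linearMap_eq_zero fun j z hz => ?_)
    by_cases hji : j = i
    · subst hji
      simpa using diff_eq_val_of_mem_eigenDist hO hT j hz
    · exact h j hji p z hz
  · rw [diff_congr (h.eventually_eq p), diff, mvfderiv_const, zero_apply]

end ConformalKilling

end PseudoRiemannian

end

theorem mainTheorem6
    {E : Type*} [NormedAddCommGroup E] [NormedSpace ℝ E] [FiniteDimensional ℝ E]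
    {M : Type*} [TopologicalSpace M] [T2Space M] [ChartedSpace E M] [IsManifold 𝓘(ℝ, E) ∞ M]
    (g : PseudoRiemannian.Metric E M) (T : PseudoRiemannian.SymTensor E M)
    {ι : Type*} [Fintype ι] (lam : ι → M → ℝ)
    (hT : PseudoRiemannian.IsOrthogonalTensor g T lam)
    (hint : PseudoRiemannian.IsOrthogonallyIntegrable g
      (fun i => PseudoRiemannian.eigenDist g T (lam i))) :
    (∀ t : ∀ p : M, PseudoRiemannian.Tan E p, PseudoRiemannian.IsConformalKilling g T t →
      ∀ i,
        (PseudoRiemannian.IsKilling g (PseudoRiemannian.eigenDist g T (lam i)) ↔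
          ∀ j, j ≠ i → ∀ p,
            PseudoRiemannian.proj g (PseudoRiemannian.eigenDist g T (lam i)) p (g.grad (lam j) p) =
              PseudoRiemannian.proj g (PseudoRiemannian.eigenDist g T (lam i)) p (t p)) ∧
        (PseudoRiemannian.IsGeodesic g (PseudoRiemannian.eigenDist g T (lam i)) ↔
          ∀ j, j ≠ i → ∀ p,
            PseudoRiemannian.proj g (PseudoRiemannian.eigenDist g T (lam j)) p (g.grad (lam i) p) =
              PseudoRiemannian.proj g (PseudoRiemannian.eigenDist g T (lam j)) p (t p))) ∧
    (PseudoRiemannian.IsKillingTensor g T →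
      ∀ i,
        (PseudoRiemannian.IsKilling g (PseudoRiemannian.eigenDist g T (lam i)) ↔
          ∀ j, PseudoRiemannian.IndependentOf (lam j)
            (PseudoRiemannian.eigenDist g T (lam i))) ∧
        (PseudoRiemannian.IsGeodesic g (PseudoRiemannian.eigenDist g T (lam i)) ↔
          IsLocallyConstant (lam i)) ∧
        (PreconnectedSpace M →
          (PseudoRiemannian.IsGeodesic g (PseudoRiemannian.eigenDist g T (lam i)) ↔
            ∃ c : ℝ, ∀ p, lam i p = c))) := by
  have := FiniteDimensional.complete ℝ E
  have hI := hint.product.isPairwiseInvolutive hint.span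
  refine ⟨fun t ht i => ⟨?_, ?_⟩, fun hK i => ⟨?_, ?_, fun hM => ?_⟩⟩
  · rw [PseudoRiemannian.isKilling_eigenDist_iff hT hI ht]
    exact forall₃_congr fun j _ p =>
      ((hint.nondegenerate i).proj_grad_eq_proj_iff (lam j)).symm
  · rw [PseudoRiemannian.isGeodesic_eigenDist_iff hT hI ht]
    exact forall₃_congr fun j _ p =>
      ((hint.nondegenerate j).proj_grad_eq_proj_iff (lam i)).symm
  · exact PseudoRiemannian.isKilling_eigenDist_iff_independentOf hT hI hK i
  · exact PseudoRiemannian.isGeodesic_eigenDist_iff_isLocallyConstant hT hI hK i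
  · rw [PseudoRiemannian.isGeodesic_eigenDist_iff_isLocallyConstant hT hI hK]
    exact ⟨fun h => h.exists_eq_const.imp fun c hc p => congrFun hc p,
      fun ⟨c, hc⟩ => IsLocallyConstant.of_constant _ fun x y => (hc x).trans (hc y).symm⟩
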